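/- **Composite IG/FTR PDF and CDF.** Let $m>0$, $V_1,V_2\ge 0$, $\sigma>0$, and let $\zeta,\phi_1,\phi_2,X,Y$ be independent, with $\zeta$ gamma distributed with shape $m$ and unit mean (density $m^m u^{m-1}e^{-mu}/\Gamma(m)$), $\phi_1,\phi_2$ uniform on $[0,2\pi)$ and $X,Y\sim\mathcal N(0,\sigma^2)$. The law of $$\left|\sqrt{\zeta}\,V_1e^{j\phi_1}+\sqrt{\zeta}\,V_2e^{j\phi_2}+X+jY\right|^2$$ is the fluctuating two-ray law $\mathrm{FTR}(\bar\gamma,m,K,\Delta)$ with $$K=\frac{V_1^2+V_2^2}{2\sigma^2},\qquad \Delta=\frac{2V_1V_2}{V_1^2+V_2^2}\ \ (\Delta=0\text{ if }V_1=V_2=0),\qquad \bar\gamma=V_1^2+V_2^2+2\sigma^2 .$$ For a random variable $X\ge 0$ with density $f_X$, let $M_X^{(n)}(s)=\int_0^\infty x^n e^{xs}f_X(x)\,dx$ for real $n\ge 0$ (generalized moment generating function, GMGF). Let $\bar Z>0$ and $Z=\bar Z\,G\,V$, where $G$ and $V$ are independent, $V\sim\mathrm{FTR}(1,m,K,\Delta)$,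 and $G$ is inverse gamma with shape $\lambda>0$ and some scale $\beta>0$ (density $\frac{\beta^\lambda}{\Gamma(\lambda)}x^{-\lambda-1}e^{-\beta/x}$ on $x>0$) such that $\mathbb E[G]=1$ (hence $\lambda>1$). Then: 1. For every such real $\lambda$, the law of $Z$ has density $f_Z$ with $f_Z(z)=0$ for $z\le 0$ and, for $z>0$, $$f_Z(z)=\frac{\bar Z^{\lambda}(\lambda-1)^{\lambda}}{z^{\lambda+1}\Gamma(\lambda)}\,M_V^{(\lambda)}\!\left(\frac{(1-\lambda)\bar Z}{z}\right),$$ where the integral defining the GMGF converges. 2. If $\lambda$ is an integer, then for $z>0$ the CDF of $Z$ is $$F_Z(z)=\sum_{n=0}^{\lambda-1}\frac{\bar Z^{n}(\lambda-1)^{n}}{z^{n}\,\Gamma(n+1)}\,M_V^{(n)}\!\left(\frac{(1-\lambda)\bar Z}{z}\right).$$ 3. For every integer $n\ge 0$ and real $s\le 0$ the integral defining $M_V^{(n)}(s)$ converges and, with $D(s)=m(1+K)-(m+K-K\Delta)s$, $$M_V^{(n)}(s)=n!\,m^m(1+K-s)^{m-n-1}\sum_{l=0}^{n}\binom nl\frac{(m)_l}{l!}\,\frac{(1+K)^{l+1}K^l}{D(s)^{m+l}}\sum_{q=0}^{l}\binom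 lq(1-\Delta)^{l-q}(2\Delta)^q\,\frac{\Gamma(\frac12+q)}{\sqrt\pi\,\Gamma(q+1)}\;{}_2F_1\!\left(m+l,\tfrac12+q;q+1;\frac{2K\Delta s}{D(s)}\right).$$ Here $(m)_l$ is the Pochhammer symbol and, for $0<b<c$ and real $x<1$, ${}_2F_1(a,b;c;x)$ is the Gauss hypergeometric function (continued analytically to $x\le -1$), that is ${}_2F_1(a,b;c;x)=\frac{\Gamma(c)}{\Gamma(b)\Gamma(c-b)}\int_0^1t^{b-1}(1-t)^{c-b-1}(1-tx)^{-a}\,dt$. 4. Consequently, if $\lambda$ is an integer, $f_Z(z)$ and $F_Z(z)$ for $z>0$ are given in closed form by inserting the expression in 3 at $s=(1-\lambda)\bar Z/z$ into 1 (with $n=\lambda$) and into 2. -/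

import Mathlib

open MeasureTheory ProbabilityTheory

noncomputable section

/-! ### The Gauss hypergeometric function -/

/-- The Gauss hypergeometric function `₂F₁(a, b; c; z)` for real `0 < b < c` and real `z < 1`, given
by Euler's integral. The integral is the analytic continuation to `z < 1` of the hypergeometric
series, which converges only for `|z| < 1`; see `gaussHypergeometric_eq_series`. -/
def gaussHypergeometric (a b c z : ℝ) : ℝ :=
  Real.Gamma c / (Real.Gamma b * Real.Gamma (c - b)) *
    ∫ t in (0 : ℝ)..1, t ^ (b - 1) * (1 - t) ^ (c - b - 1) * (1 - t * z) ^ (-a)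

theorem euler_beta_integral {u v : ℝ} (hu : 0 < u) (hv : 0 < v) :
    IntegrableOn (fun t : ℝ => t ^ (u - 1) * (1 - t) ^ (v - 1)) (Set.Ioo 0 1) ∧
    ∫ t in Set.Ioo (0 : ℝ) 1, t ^ (u - 1) * (1 - t) ^ (v - 1)
      = Real.Gamma u * Real.Gamma v / Real.Gamma (u + v) := by
  have hI : Integrable (betaPDFReal u v) := by
    refine ⟨(measurable_betaPDFReal u v).aestronglyMeasurable, ?_⟩
    have h := lintegral_betaPDF_eq_one hu hv
    rw [hasFiniteIntegral_iff_ofReal]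
    · show ∫⁻ x, betaPDF u v x < ⊤
      rw [h]; exact ENNReal.one_lt_top
    · refine Filter.Eventually.of_forall fun x => ?_
      by_cases hx : 0 < x ∧ x < 1
      · exact (betaPDFReal_pos hx.1 hx.2 hu hv).le
      · simp [betaPDFReal, hx]
  have hB := beta_pos hu hv
  have hind : (fun x => beta u v * betaPDFReal u v x) =
      (Set.Ioo (0 : ℝ) 1).indicator (fun t : ℝ => t ^ (u - 1) * (1 - t) ^ (v - 1)) := by
    funext x
    by_cases hx : 0 < x ∧ x < 1
    · rw [Set.indicator_of_mem (show x ∈ Set.Ioo (0 : ℝ) 1 from hx)]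
      simp only [betaPDFReal, hx, and_self, if_true]
      field_simp
    · rw [Set.indicator_of_notMem (show x ∉ Set.Ioo (0 : ℝ) 1 from hx)]
      simp [betaPDFReal, hx]
  refine ⟨?_, ?_⟩
  · rw [← integrable_indicator_iff measurableSet_Ioo, ← hind]
    exact hI.const_mul _
  · rw [← integral_indicator measurableSet_Ioo, ← hind, integral_const_mul]
    have h1 : ∫ x, betaPDFReal u v x = 1 := by
      rw [integral_eq_lintegral_of_nonneg_ae _ hI.1]
      · show (∫⁻ x, betaPDF u v x).toReal = 1
        rw [lintegral_betaPDF_eq_one hu hv]; simp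
      · refine Filter.Eventually.of_forall fun x => ?_
        by_cases hx : 0 < x ∧ x < 1
        · exact (betaPDFReal_pos hx.1 hx.2 hu hv).le
        · simp [betaPDFReal, hx]
    rw [h1, mul_one, beta]

theorem gamma_add_nat_eq {x : ℝ} (hx : 0 < x) (n : ℕ) :
    Real.Gamma (x + n) = (ascPochhammer ℝ n).eval x * Real.Gamma x := by
  induction n with
  | zero => simp
  | succ n ih =>
    have h : x + (n + 1 : ℕ) = (x + n) + 1 := by push_cast; ring
    rw [h, Real.Gamma_add_one (by positivity), ih, ascPochhammer_succ_right]
    simp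
    ring

theorem binomial_series_hasSum (a : ℝ) {x : ℝ} (hx : |x| < 1) :
    HasSum (fun n : ℕ => ((n.factorial : ℝ)⁻¹ * (ascPochhammer ℝ n).eval a) * x ^ n)
      ((1 - x) ^ (-a)) := by
  have h := (Real.one_add_rpow_hasFPowerSeriesOnBall_zero (a := -a)).hasSum
    (y := -x) (by simpa [Metric.mem_eball, edist_zero_right, enorm_eq_nnnorm, ← NNReal.coe_lt_one]
      using hx)
  rw [binomialSeries_eq_ordinaryHypergeometricSeries (b := (1 : ℝ))
    (by intro k; have : (0 : ℝ) ≤ k := k.cast_nonneg; linarith)] at h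
  simp only [FormalMultilinearSeries.compContinuousLinearMap_apply, zero_add, neg_neg] at h
  rw [show (1 : ℝ) + -x = 1 - x by ring] at h
  have hfun : (fun n : ℕ => ((n.factorial : ℝ)⁻¹ * (ascPochhammer ℝ n).eval a) * x ^ n) =
      fun n => (ordinaryHypergeometricSeries ℝ a 1 1 n)
        ((-ContinuousLinearMap.id ℝ ℝ) ∘ fun _ => -x) := by
    funext n
    have h1 : (ascPochhammer ℝ n).eval 1 ≠ 0 := by
      rw [ascPochhammer_eval_one]; positivity
    have h2 := ordinaryHypergeometricSeries_apply_eq a (1 : ℝ) 1 x n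
    rw [mul_assoc _ _ (Polynomial.eval 1 _)⁻¹, mul_inv_cancel₀ h1, mul_one, smul_eq_mul] at h2
    rw [← h2]
    congr 1
    funext i
    simp
  rw [hfun]
  exact h

/-- On the unit interval Euler's integral is the sum of the hypergeometric series. -/
theorem gaussHypergeometric_eq_series {a b c z : ℝ} (hb : 0 < b) (hbc : b < c) (hz : |z| < 1) :
    gaussHypergeometric a b c z = ordinaryHypergeometric a b c z := by
  have hv : 0 < c - b := by linarith
  have hc : 0 < c := by linarith
  set co : ℕ → ℝ := fun n => (n.factorial : ℝ)⁻¹ * (ascPochhammer ℝ n).eval a with hco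
  set F : ℕ → ℝ → ℝ := fun n t =>
    co n * z ^ n * (t ^ (b + n - 1) * (1 - t) ^ (c - b - 1)) with hF
  have hbn : ∀ n : ℕ, 0 < b + n := fun n => by positivity
  have hint : ∀ n, Integrable (F n) (volume.restrict (Set.Ioo 0 1)) := fun n =>
    (euler_beta_integral (hbn n) hv).1.const_mul _
  have hval : ∀ n, ∫ t in Set.Ioo (0 : ℝ) 1, F n t =
      co n * z ^ n * (Real.Gamma (b + n) * Real.Gamma (c - b) / Real.Gamma (b + n + (c - b))) :=
    fun n => by
      simp only [hF]
      rw [integral_const_mul, (euler_beta_integral (hbn n) hv).2]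
  have hsumabs : Summable fun n => |co n * z ^ n| := (binomial_series_hasSum a hz).summable.abs
  have hsum : Summable fun n => ∫ t in Set.Ioo (0 : ℝ) 1, ‖F n t‖ := by
    refine Summable.of_nonneg_of_le (fun n => integral_nonneg fun t => norm_nonneg _) (fun n => ?_)
      (hsumabs.mul_right (∫ t in Set.Ioo (0 : ℝ) 1, t ^ (b - 1) * (1 - t) ^ (c - b - 1)))
    rw [← integral_const_mul]
    refine setIntegral_mono_on (hint n).norm
      ((euler_beta_integral hb hv).1.const_mul _) measurableSet_Ioo fun t ht => ?_
    have ht0 := ht.1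
    have ht1 : 0 < 1 - t := by linarith [ht.2]
    rw [hF, Real.norm_eq_abs, abs_mul]
    refine mul_le_mul_of_nonneg_left ?_ (abs_nonneg _)
    rw [abs_of_nonneg (by positivity)]
    refine mul_le_mul_of_nonneg_right ?_ (by positivity)
    exact Real.rpow_le_rpow_of_exponent_ge ht0 ht.2.le
      (by have : (0 : ℝ) ≤ n := n.cast_nonneg
          linarith)
  have key := hasSum_integral_of_summable_integral_norm hint hsum
  have hpt : ∫ t in Set.Ioo (0 : ℝ) 1, ∑' n, F n t =
      ∫ t in Set.Ioo (0 : ℝ) 1, t ^ (b - 1) * (1 - t) ^ (c - b - 1) * (1 - t * z) ^ (-a) := by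
    refine setIntegral_congr_fun measurableSet_Ioo fun t ht => ?_
    have ht0 : 0 < t := ht.1
    have htz : |t * z| < 1 := by
      rw [abs_mul, abs_of_pos ht0]
      nlinarith [abs_nonneg z, ht.2]
    have h := (binomial_series_hasSum a htz).mul_left (t ^ (b - 1) * (1 - t) ^ (c - b - 1))
    rw [← h.tsum_eq]
    refine tsum_congr fun n => ?_
    have : t ^ (b + n - 1) = t ^ (b - 1) * t ^ n := by
      rw [← Real.rpow_natCast, ← Real.rpow_add ht0]; congr 1; ring
    simp only [hF, hco, this, mul_pow]
    ring
  rw [gaussHypergeometric, intervalIntegral.integral_of_le zero_le_one,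
    integral_Ioc_eq_integral_Ioo, ← hpt, ← key.tsum_eq, ← tsum_mul_left,
    ordinaryHypergeometric_eq_tsum]
  refine tsum_congr fun n => ?_
  rw [hval, gamma_add_nat_eq hb, show b + n + (c - b) = c + n by ring, gamma_add_nat_eq hc]
  have h1 := (Real.Gamma_pos_of_pos hb).ne'
  have h2 := (Real.Gamma_pos_of_pos hv).ne'
  have h3 := (Real.Gamma_pos_of_pos hc).ne'
  have h4 := (ascPochhammer_pos n c hc).ne'
  simp only [hco, smul_eq_mul]
  field_simp

/-! ### Inverse gamma and fluctuating two-ray laws -/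

/-- The inverse gamma law with shape `lam` and scale `β`. -/
def inverseGammaMeasure (lam β : ℝ) : Measure ℝ :=
  volume.withDensity fun x => ENNReal.ofReal
    (if 0 < x then β ^ lam / Real.Gamma lam * x ^ (-lam - 1) * Real.exp (-(β / x)) else 0)

/-- The uniform law on `[0, 2π)`. -/
def uniformPhase : Measure ℝ := cond volume (Set.Ico 0 (2 * Real.pi))

/-- The complex baseband signal
`√ζ V₁ exp (j φ₁) + √ζ V₂ exp (j φ₂) + X + j Y`. -/
def twoRaySignal (V₁ V₂ ζ φ₁ φ₂ X Y : ℝ) : ℂ :=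
  (√ζ * V₁ : ℝ) * Complex.exp (φ₁ * Complex.I) + (√ζ * V₂ : ℝ) * Complex.exp (φ₂ * Complex.I)
    + X + Y * Complex.I

/-- The joint law of the independent variables `(ζ, φ₁, φ₂, X, Y)`: `ζ` is gamma distributed with
shape `m` and unit mean, `φ₁, φ₂` are uniform phases, and `X, Y` are centred Gaussian variables of
variance `σ²`. -/
def twoRayInputLaw (m σ : ℝ) : Measure (ℝ × ℝ × ℝ × ℝ × ℝ) :=
  (gammaMeasure m m).prod (uniformPhase.prod (uniformPhase.prod
    ((gaussianReal 0 (σ ^ 2).toNNReal).prod (gaussianReal 0 (σ ^ 2).toNNReal))))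

/-- The law of the instantaneous power of the two-ray signal with fluctuating specular components. -/
def twoRayPowerLaw (m V₁ V₂ σ : ℝ) : Measure ℝ :=
  (twoRayInputLaw m σ).map fun w =>
    ‖twoRaySignal V₁ V₂ w.1 w.2.1 w.2.2.1 w.2.2.2.1 w.2.2.2.2‖ ^ 2

/-- `γ ∼ FTR(γbar, m, K, Δ)`: the random variable `γ` is distributed as the power of a fluctuating
two-ray signal with amplitudes `V₁, V₂ ≥ 0` and diffuse power `2σ² > 0` that are related to the
parameters by `K = (V₁² + V₂²) / (2σ²)`, `Δ = 2 V₁ V₂ / (V₁² + V₂²)` and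
`γbar = V₁² + V₂² + 2σ²`. (If `V₁ = V₂ = 0`, then `Δ = 0`.) -/
def IsFTR {Ω : Type*} [MeasurableSpace Ω] (γ : Ω → ℝ) (P : Measure Ω) (γbar m K Δ : ℝ) : Prop :=
  0 < m ∧ ∃ V₁ V₂ σ : ℝ, 0 ≤ V₁ ∧ 0 ≤ V₂ ∧ 0 < σ ∧
    K = (V₁ ^ 2 + V₂ ^ 2) / (2 * σ ^ 2) ∧
    Δ = 2 * V₁ * V₂ / (V₁ ^ 2 + V₂ ^ 2) ∧
    γbar = V₁ ^ 2 + V₂ ^ 2 + 2 * σ ^ 2 ∧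
    HasLaw γ (twoRayPowerLaw m V₁ V₂ σ) P

/-! ### The generalized moment generating function -/

/-- The integrand `x ^ n * exp (x s) * f_X(x)` of the generalized moment generating function. -/
def gmgfIntegrand {Ω : Type*} [MeasurableSpace Ω] (X : Ω → ℝ) (P : Measure Ω) (n s x : ℝ) : ℝ :=
  x ^ n * Real.exp (x * s) * (pdf X P volume x).toReal

/-- The generalized moment generating function `M_X^{(n)}(s) = ∫₀^∞ x ^ n exp (x s) f_X(x) dx`,
of real order `n`. -/
def gmgf {Ω : Type*} [MeasurableSpace Ω] (X : Ω → ℝ) (P : Measure Ω) (n s : ℝ) : ℝ :=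
  ∫ x in Set.Ioi (0 : ℝ), gmgfIntegrand X P n s x

/-- The closed form of the generalized moment generating function, of integer order `n`, of a
variable with law `FTR(γbar, m, K, Δ)`. -/
def ftrGMGF (γbar m K Δ : ℝ) (n : ℕ) (s : ℝ) : ℝ :=
  n.factorial * m ^ m * (1 + K - γbar * s) ^ (m - n - 1) * γbar ^ n *
    ∑ l ∈ Finset.range (n + 1),
      (n.choose l : ℝ) * ((ascPochhammer ℝ l).eval m / l.factorial) *
      ((1 + K) ^ (l + 1) * K ^ l /
        (m * (1 + K) - (m + K - K * Δ) * γbar * s) ^ (m + l)) *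
      ∑ q ∈ Finset.range (l + 1),
        (l.choose q : ℝ) * (1 - Δ) ^ (l - q) * (2 * Δ) ^ q *
        (Real.Gamma (1 / 2 + q) / (√Real.pi * Real.Gamma (q + 1))) *
        gaussHypergeometric (m + l) (1 / 2 + q) (q + 1)
          (2 * K * Δ * γbar * s / (m * (1 + K) - (m + K - K * Δ) * γbar * s))

/-! ### The composite inverse gamma / fluctuating two-ray model -/

/-- The density of the composite variable at `z`, in terms of the generalized moment generating
function of the fading variable `V`. -/
def compositePDF {Ω : Type*} [MeasurableSpace Ω] (V : Ω → ℝ) (P : Measure Ω) (Zbar lam z : ℝ) : ℝ :=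
  if 0 < z then
    Zbar ^ lam * (lam - 1) ^ lam / (z ^ (lam + 1) * Real.Gamma lam) *
      gmgf V P lam ((1 - lam) * Zbar / z)
  else 0

end

noncomputable section

/-! ### Moments of a noncentral chi-squared variable with two degrees of freedom -/

/-! Two conditioning arguments carry the theorem.

Composite law: unit mean forces `β = lam - 1` (`inverseGamma_scale_of_mean_one`). Given `V = v > 0`,
`Z` is inverse gamma of scale `Zbar * v * (lam - 1)`. Its density at `z` is a factor free of `v`
times `v ^ lam * exp (v * s)` with `s = (1 - lam) * Zbar / z`, so averaging over `V` produces the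
GMGF of order `lam` (`hasLaw_composite`). For integer shape the inverse gamma distribution function
is a finite Poisson sum (`inverseGammaMeasure_Iic`), whose terms average to GMGFs of integer order
(`cdf_composite`).

Closed form: given fading and phases, the power is the squared norm of a shifted planar Gaussian.
Its moment generating function comes from completing the square, and `n` derivatives in `s` bring in
a Laguerre polynomial in the specular power (`integral_pow_mul_exp_shiftedSqNorm`). That power is
`ζ` times a function of the phase difference, itself a uniform phase modulo `2π`. Averaging over `ζ`
termwise gives gamma integrals. With `τ = (1 + cos φ) / 2`, the base of the resulting real power is
affine in `τ` and `1 + Δ cos φ = (1 - Δ) + 2Δτ` is expanded binomially, so the phase average is a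
sum of Euler integrals (`phase_average_eq_gaussHypergeometric`).

The averages over the two-ray inputs are lower Lebesgue integrals of nonnegative functions, so
Tonelli applies freely and finiteness of the result yields convergence. -/

theorem gaussianPDFReal_mul_exp_sq {v : NNReal} (hv : v ≠ 0) {s : ℝ} (hs : 2 * v * s < 1)
    (a x : ℝ) :
    gaussianPDFReal 0 v x * Real.exp (s * (a + x) ^ 2) =
      (√(2 * Real.pi * v))⁻¹ * Real.exp (s * a ^ 2 / (1 - 2 * v * s)) *
        Real.exp (-((1 - 2 * v * s) / (2 * v)) * (x - 2 * v * s * a / (1 - 2 * v * s)) ^ 2) := by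
  have hv' : (v : ℝ) ≠ 0 := by exact_mod_cast hv
  have hw : 1 - 2 * v * s ≠ 0 := by linarith
  rw [gaussianPDFReal, mul_assoc _⁻¹, mul_assoc _⁻¹, ← Real.exp_add, ← Real.exp_add]
  congr 2
  field_simp
  ring

theorem integrable_exp_sq_gaussianReal {v : NNReal} (hv : v ≠ 0) {s : ℝ} (hs : 2 * v * s < 1)
    (a : ℝ) : Integrable (fun x => Real.exp (s * (a + x) ^ 2)) (gaussianReal 0 v) := by
  have hv' : 0 < (v : ℝ) := by positivity
  have hw : 0 < 1 - 2 * v * s := by linarith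
  rw [gaussianReal_of_var_ne_zero 0 hv, integrable_withDensity_iff_integrable_smul'
    (measurable_gaussianPDF 0 v) (by simp [gaussianPDF_lt_top])]
  simp only [toReal_gaussianPDF, smul_eq_mul, gaussianPDFReal_mul_exp_sq hv hs]
  exact ((integrable_exp_neg_mul_sq (div_pos hw (by positivity))).comp_sub_right _).const_mul _

theorem integral_exp_sq_gaussianReal {v : NNReal} (hv : v ≠ 0) {s : ℝ} (hs : 2 * v * s < 1)
    (a : ℝ) : ∫ x, Real.exp (s * (a + x) ^ 2) ∂gaussianReal 0 v =
      (√(1 - 2 * v * s))⁻¹ * Real.exp (s * a ^ 2 / (1 - 2 * v * s)) := by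
  have hv' : 0 < (v : ℝ) := by positivity
  have hw : 0 < 1 - 2 * v * s := by linarith
  rw [integral_gaussianReal_eq_integral_smul hv]
  simp only [smul_eq_mul, gaussianPDFReal_mul_exp_sq hv hs]
  rw [integral_const_mul, integral_sub_right_eq_self
    (fun x => Real.exp (-((1 - 2 * v * s) / (2 * v)) * x ^ 2)), integral_gaussian,
    show Real.pi / ((1 - 2 * v * s) / (2 * v)) = (2 * Real.pi * v) / (1 - 2 * v * s) by
      field_simp, Real.sqrt_div' _ hw.le]
  have h1 : √(2 * Real.pi * v) ≠ 0 := by positivity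
  have h2 : √(1 - 2 * v * s) ≠ 0 := by positivity
  field_simp

/-- The squared norm of the vector `(a + x, b + y)`. -/
def shiftedSqNorm (a b : ℝ) (p : ℝ × ℝ) : ℝ := (a + p.1) ^ 2 + (b + p.2) ^ 2

theorem integrable_exp_shiftedSqNorm {v : NNReal} (hv : v ≠ 0) {s : ℝ} (hs : 2 * v * s < 1)
    (a b : ℝ) : Integrable (fun p => Real.exp (s * shiftedSqNorm a b p))
      ((gaussianReal 0 v).prod (gaussianReal 0 v)) := by
  simp only [shiftedSqNorm, mul_add, Real.exp_add]
  exact (integrable_exp_sq_gaussianReal hv hs a).mul_prod (integrable_exp_sq_gaussianReal hv hs b)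

theorem integral_exp_shiftedSqNorm {v : NNReal} (hv : v ≠ 0) {s : ℝ} (hs : 2 * v * s < 1)
    (a b : ℝ) : ∫ p, Real.exp (s * shiftedSqNorm a b p)
      ∂((gaussianReal 0 v).prod (gaussianReal 0 v)) =
      (1 - 2 * v * s)⁻¹ * Real.exp (s * (a ^ 2 + b ^ 2) / (1 - 2 * v * s)) := by
  have hw : 0 ≤ 1 - 2 * v * s := by linarith
  simp only [shiftedSqNorm, mul_add, Real.exp_add]
  rw [integral_prod_mul (fun x => Real.exp (s * (a + x) ^ 2)) (fun x => Real.exp (s * (b + x) ^ 2)),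
    integral_exp_sq_gaussianReal hv hs, integral_exp_sq_gaussianReal hv hs, add_div, Real.exp_add]
  nth_rewrite 5 [← Real.mul_self_sqrt hw]
  rw [mul_inv]
  ring

/-- The closed form of `E[R ^ n * exp (s R)]`, where `R` is the squared norm of a planar Gaussian
vector with covariance `(c / 2) • 1` whose mean has squared norm `r`. -/
def noncentralGMGF (c r : ℝ) (n : ℕ) (s : ℝ) : ℝ :=
  n.factorial * c ^ n * ((1 - c * s)⁻¹) ^ (n + 1) * Real.exp (s * r / (1 - c * s)) *
    ∑ l ∈ Finset.range (n + 1), (n.choose l : ℝ) / l.factorial * (r / (c * (1 - c * s))) ^ l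

/-- With `f n x = L_n(-x)` for the Laguerre polynomial `L_n`, this is `(n+1) f_n + x f_n' + x f_n =
(n+1) f_{n+1}`. Comparing coefficients leaves Pascal's rule and the absorption identity for
binomials. -/
theorem laguerre_sum_succ (n : ℕ) (x : ℝ) :
    (∑ l ∈ Finset.range (n + 1), (n.choose l : ℝ) / l.factorial * ((n + 1 + l) * x ^ l)) +
      x * ∑ l ∈ Finset.range (n + 1), (n.choose l : ℝ) / l.factorial * x ^ l =
    (n + 1) * ∑ l ∈ Finset.range (n + 2), ((n + 1).choose l : ℝ) / l.factorial * x ^ l := by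
  -- The extra term vanishes because `n.choose (n + 1) = 0`; it aligns this sum with the range on
  -- the right.
  have h0 : (∑ l ∈ Finset.range (n + 1), (n.choose l : ℝ) / l.factorial * ((n + 1 + l) * x ^ l)) =
      ∑ l ∈ Finset.range (n + 2), (n.choose l : ℝ) / l.factorial * ((n + 1 + l) * x ^ l) := by
    rw [Finset.sum_range_succ _ (n + 1)]; simp
  rw [h0, Finset.sum_range_succ', Finset.sum_range_succ' _ (n + 1), Finset.mul_sum, add_right_comm,
    ← Finset.sum_add_distrib, mul_add, Finset.mul_sum]
  congr 1
  · refine Finset.sum_congr rfl fun l _ => ?_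
    have h1 : ((n + 1).choose (l + 1) : ℝ) = n.choose l + n.choose (l + 1) := by
      exact_mod_cast Nat.choose_succ_succ n l
    have h2 : ((n + 1 : ℕ) : ℝ) * n.choose l = (n + 1).choose (l + 1) * (l + 1 : ℕ) := by
      exact_mod_cast Nat.add_one_mul_choose_eq n l
    have h3 : ((l + 1).factorial : ℝ) = (l + 1) * l.factorial := by
      push_cast [Nat.factorial_succ]; ring
    rw [h3]
    push_cast at h2 ⊢
    have h4 : (l.factorial : ℝ) ≠ 0 := by positivity
    field_simp
    rw [h1] at h2 ⊢
    linear_combination (-(x * x ^ l)) * h2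
  · simp

/-- Write `w = (1 - c s)⁻¹`, so `w' = c w²` and the exponent has derivative `r w²`. Differentiating
`w ^ (n + 1 + l)` supplies the factor `n + 1 + l` and the exponential supplies `x`, which are the
two sums of `laguerre_sum_succ`. -/
theorem hasDerivAt_noncentralGMGF {c : ℝ} (hc : 0 < c) (r : ℝ) (n : ℕ) {s : ℝ} (hs : c * s < 1) :
    HasDerivAt (noncentralGMGF c r n) (noncentralGMGF c r (n + 1) s) s := by
  have hw : 1 - c * s ≠ 0 := by linarith
  have hw1 : HasDerivAt (fun s => 1 - c * s) (-c) s := by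
    simpa using ((hasDerivAt_id s).const_mul c).const_sub 1
  have hinv : HasDerivAt (fun s => (1 - c * s)⁻¹) (c * ((1 - c * s)⁻¹) ^ 2) s :=
    (hw1.fun_inv hw).congr_deriv (by field_simp)
  have hexp : HasDerivAt (fun s => Real.exp (s * r / (1 - c * s)))
      (Real.exp (s * r / (1 - c * s)) * (r * ((1 - c * s)⁻¹) ^ 2)) s :=
    (((hasDerivAt_id' s).mul_const r).fun_div hw1 hw).exp.congr_deriv (by
      congr 1
      field_simp
      ring)
  have hpow : ∀ l : ℕ, HasDerivAt (fun s => (n.choose l : ℝ) / l.factorial *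
      ((r / c) ^ l * ((1 - c * s)⁻¹) ^ (n + 1 + l)))
      ((n.choose l : ℝ) / l.factorial * ((r / c) ^ l *
        ((n + 1 + l) * (c * ((1 - c * s)⁻¹) ^ (n + 2 + l))))) s := fun l =>
    (((hinv.fun_pow (n + 1 + l)).const_mul ((r / c) ^ l)).const_mul
      ((n.choose l : ℝ) / l.factorial)).congr_deriv (by
        rw [show n + 1 + l - 1 = n + l by omega]
        push_cast
        ring)
  have hsum := HasDerivAt.fun_sum (u := Finset.range (n + 1)) fun l _ => hpow l
  have hall := ((hexp.mul hsum).const_mul (n.factorial * c ^ n : ℝ))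
  have hfun : noncentralGMGF c r n = fun s => n.factorial * c ^ n *
      (Real.exp (s * r / (1 - c * s)) * ∑ l ∈ Finset.range (n + 1), (n.choose l : ℝ) / l.factorial *
      ((r / c) ^ l * ((1 - c * s)⁻¹) ^ (n + 1 + l))) := by
    funext t
    have : ∀ l, (n.choose l : ℝ) / l.factorial * ((r / c) ^ l * ((1 - c * t)⁻¹) ^ (n + 1 + l)) =
        ((1 - c * t)⁻¹) ^ (n + 1) *
        ((n.choose l : ℝ) / l.factorial * (r / (c * (1 - c * t))) ^ l) := fun l => by
      rw [div_mul_eq_div_div, div_eq_mul_inv (r / c), mul_pow (r / c)]; ring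
    simp only [this, ← Finset.mul_sum]
    rw [noncentralGMGF]; ring
  rw [hfun]
  refine hall.congr_deriv ?_
  set E := Real.exp (s * r / (1 - c * s))
  set x := r / (c * (1 - c * s)) with hx
  have key := laguerre_sum_succ n x
  have e1 : ∀ l, (n.choose l : ℝ) / l.factorial * ((r / c) ^ l *
        ((n + 1 + l) * (c * ((1 - c * s)⁻¹) ^ (n + 2 + l)))) =
      c * ((1 - c * s)⁻¹) ^ (n + 2) * ((n.choose l : ℝ) / l.factorial * ((n + 1 + l) * x ^ l)) :=
    fun l => by
      rw [hx, div_mul_eq_div_div, div_eq_mul_inv (r / c), mul_pow (r / c)]; ring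
  have e2 : ∀ l, (n.choose l : ℝ) / l.factorial * ((r / c) ^ l *
        ((1 - c * s)⁻¹) ^ (n + 1 + l)) =
      ((1 - c * s)⁻¹) ^ (n + 1) * ((n.choose l : ℝ) / l.factorial * x ^ l) :=
    fun l => by
      rw [hx, div_mul_eq_div_div, div_eq_mul_inv (r / c), mul_pow (r / c)]; ring
  simp only [e1, e2, ← Finset.mul_sum]
  have hx2 : r * ((1 - c * s)⁻¹) ^ 2 = c * (1 - c * s)⁻¹ * x := by
    rw [hx]; field_simp
  rw [hx2, noncentralGMGF, Nat.factorial_succ]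
  push_cast
  linear_combination ((n.factorial * c ^ (n + 1) * E * ((1 - c * s)⁻¹) ^ (n + 2))) * key

theorem mem_interior_integrableExpSet_shiftedSqNorm {v : NNReal} (hv : v ≠ 0) {s : ℝ}
    (hs : 2 * v * s < 1) (a b : ℝ) :
    s ∈ interior (integrableExpSet (shiftedSqNorm a b)
      ((gaussianReal 0 v).prod (gaussianReal 0 v))) := by
  refine interior_maximal (s := _) (t := {s : ℝ | 2 * v * s < 1}) (fun t ht => ?_)
    (isOpen_lt (by fun_prop) (by fun_prop)) hs
  exact integrable_exp_shiftedSqNorm hv ht a b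

/-- Differentiation in `s` raises the order by one on both sides, so induction and uniqueness of
derivatives reduce everything to the moment generating function. -/
theorem integral_pow_mul_exp_shiftedSqNorm {v : NNReal} (hv : v ≠ 0) (a b : ℝ) (n : ℕ) {s : ℝ}
    (hs : 2 * v * s < 1) :
    ∫ p, shiftedSqNorm a b p ^ n * Real.exp (s * shiftedSqNorm a b p)
      ∂((gaussianReal 0 v).prod (gaussianReal 0 v)) =
      noncentralGMGF (2 * v) (a ^ 2 + b ^ 2) n s := by
  have hv' : 0 < (v : ℝ) := by positivity
  induction n generalizing s with
  | zero => simp [noncentralGMGF, integral_exp_shiftedSqNorm hv hs]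
  | succ n ih =>
    refine HasDerivAt.unique (hasDerivAt_integral_pow_mul_exp_real
      (mem_interior_integrableExpSet_shiftedSqNorm hv hs a b) n) ?_
    refine (hasDerivAt_noncentralGMGF (by positivity) _ n hs).congr_of_eventuallyEq ?_
    filter_upwards [(isOpen_lt (f := fun s : ℝ => 2 * v * s) (g := fun _ => 1) (by fun_prop)
      (by fun_prop)).mem_nhds hs] with t ht using ih ht

theorem shiftedSqNorm_nonneg (a b : ℝ) (p : ℝ × ℝ) : 0 ≤ shiftedSqNorm a b p := by
  unfold shiftedSqNorm; positivity

theorem lintegral_pow_mul_exp_shiftedSqNorm {v : NNReal} (hv : v ≠ 0) (a b : ℝ) (n : ℕ) {s : ℝ}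
    (hs : 2 * v * s < 1) :
    ∫⁻ p, ENNReal.ofReal (shiftedSqNorm a b p ^ n * Real.exp (s * shiftedSqNorm a b p))
      ∂((gaussianReal 0 v).prod (gaussianReal 0 v)) =
      ENNReal.ofReal (noncentralGMGF (2 * v) (a ^ 2 + b ^ 2) n s) := by
  rw [← integral_pow_mul_exp_shiftedSqNorm hv a b n hs, ofReal_integral_eq_lintegral_ofReal]
  · exact integrable_pow_mul_exp_of_mem_interior_integrableExpSet
      (mem_interior_integrableExpSet_shiftedSqNorm hv hs a b) n
  · exact Filter.Eventually.of_forall fun p =>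
      mul_nonneg (pow_nonneg (shiftedSqNorm_nonneg a b p) n) (Real.exp_pos _).le

/-! ### Averages over gamma variables and uniform phases -/

theorem gammaPDFReal_mul_pow_mul_exp {m c x : ℝ} (l : ℕ) (hx : 0 < x) :
    gammaPDFReal m m x * (x ^ l * Real.exp (-(c * x))) =
      m ^ m / Real.Gamma m * (x ^ (m + l - 1) * Real.exp (-((m + c) * x))) := by
  rw [gammaPDFReal, if_pos hx.le, show m + l - 1 = (m - 1) + l by ring, Real.rpow_add hx,
    Real.rpow_natCast, show -((m + c) * x) = -(m * x) + -(c * x) by ring, Real.exp_add]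
  ring

theorem measurable_gammaPDF (a r : ℝ) : Measurable (gammaPDF a r) :=
  (measurable_gammaPDFReal a r).ennreal_ofReal

theorem integral_gammaMeasure_eq (m r : ℝ) (f : ℝ → ℝ) (hm : 0 < m) (hr : 0 < r) :
    ∫ x, f x ∂gammaMeasure m r = ∫ x in Set.Ioi 0, gammaPDFReal m r x * f x := by
  rw [gammaMeasure, integral_withDensity_eq_integral_toReal_smul
    (measurable_gammaPDF m r) (by simp [gammaPDF]),
    ← integral_Ici_eq_integral_Ioi]
  simp only [gammaPDF, ENNReal.toReal_ofReal (gammaPDFReal_nonneg hm hr _), smul_eq_mul]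
  refine (setIntegral_eq_integral_of_forall_compl_eq_zero fun x hx => ?_).symm
  rw [gammaPDFReal, if_neg (by simpa using hx), zero_mul]

theorem integral_pow_mul_exp_gammaMeasure {m c : ℝ} (hm : 0 < m) (hc : 0 ≤ c) (l : ℕ) :
    ∫ x, x ^ l * Real.exp (-(c * x)) ∂gammaMeasure m m =
      m ^ m * (ascPochhammer ℝ l).eval m / (m + c) ^ (m + l) := by
  have hmc : 0 < m + c := by linarith
  rw [integral_gammaMeasure_eq m m _ hm hm, setIntegral_congr_fun measurableSet_Ioi
    (fun x hx => gammaPDFReal_mul_pow_mul_exp l hx), integral_const_mul,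
    Real.integral_rpow_mul_exp_neg_mul_Ioi (by positivity) hmc, gamma_add_nat_eq hm, one_div,
    Real.inv_rpow hmc.le]
  have := (Real.Gamma_pos_of_pos hm).ne'
  field_simp

theorem integrable_pow_mul_exp_gammaMeasure {m c : ℝ} (hm : 0 < m) (hc : 0 ≤ c) (l : ℕ) :
    Integrable (fun x => x ^ l * Real.exp (-(c * x))) (gammaMeasure m m) := by
  have hmc : 0 < m + c := by linarith
  -- The Bochner integral of a nonintegrable function is zero, so the nonzero value already computed
  -- forces integrability.
  refine not_imp_comm.1 integral_undef ?_
  rw [integral_pow_mul_exp_gammaMeasure hm hc]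
  have := ascPochhammer_pos l m hm
  positivity

theorem ae_pos_gammaMeasure (m r : ℝ) : ∀ᵐ x ∂gammaMeasure m r, 0 ≤ x := by
  rw [gammaMeasure, ae_withDensity_iff (measurable_gammaPDF m r)]
  refine Filter.Eventually.of_forall fun x hx => ?_
  by_contra! h
  exact hx (gammaPDF_of_neg h)

instance : IsProbabilityMeasure uniformPhase :=
  cond_isProbabilityMeasure_of_finite (by simp [Real.pi_pos])
    (by rw [Real.volume_Ico]; exact ENNReal.ofReal_ne_top)

theorem lintegral_ofReal_uniformPhase {h : ℝ → ℝ} (hc : Continuous h) (h0 : ∀ φ, 0 ≤ h φ) :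
    ∫⁻ φ, ENNReal.ofReal (h φ) ∂uniformPhase =
      ENNReal.ofReal ((2 * Real.pi)⁻¹ * ∫ φ in (0 : ℝ)..2 * Real.pi, h φ) := by
  have hpi : 0 < 2 * Real.pi := by positivity
  rw [uniformPhase, ProbabilityTheory.cond, lintegral_smul_measure, ← ofReal_integral_eq_lintegral_ofReal,
    intervalIntegral.integral_of_le hpi.le, integral_Ico_eq_integral_Ioc, Real.volume_Ico, sub_zero,
    ← ENNReal.ofReal_inv_of_pos hpi, ENNReal.ofReal_mul (by positivity), smul_eq_mul]
  · exact hc.integrableOn_Icc.mono_set Set.Ico_subset_Icc_self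
  · exact Filter.Eventually.of_forall h0

/-- The difference of two independent uniform phases is a uniform phase, modulo `2π`. -/
theorem lintegral_lintegral_uniformPhase_sub {h : ℝ → ℝ} (hc : Continuous h) (h0 : ∀ φ, 0 ≤ h φ)
    (hp : Function.Periodic h (2 * Real.pi)) :
    ∫⁻ φ₁, ∫⁻ φ₂, ENNReal.ofReal (h (φ₁ - φ₂)) ∂uniformPhase ∂uniformPhase =
      ∫⁻ φ, ENNReal.ofReal (h φ) ∂uniformPhase := by
  -- An integral over a full period is unaffected by shift and reflection, so the inner average does
  -- not depend on `φ₁`.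
  have key : ∀ φ₁ : ℝ, ∫⁻ φ₂, ENNReal.ofReal (h (φ₁ - φ₂)) ∂uniformPhase =
      ∫⁻ φ, ENNReal.ofReal (h φ) ∂uniformPhase := fun φ₁ => by
    rw [lintegral_ofReal_uniformPhase hc h0, lintegral_ofReal_uniformPhase (by fun_prop)
      (fun _ => h0 _), intervalIntegral.integral_comp_sub_left h φ₁, sub_zero]
    have := hp.intervalIntegral_add_eq (φ₁ - 2 * Real.pi) 0
    rw [sub_add_cancel, zero_add] at this
    rw [this]
  simp [key]

/-- Evenness and periodicity fold the circle onto `(0, π)`, whence the factor 2. There `t = (1 + cos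
φ) / 2` is injective with Jacobian `sin φ / 2 = √(t (1 - t))`, which the beta weight cancels. -/
theorem integral_comp_cos_sq_half {g : ℝ → ℝ}
    (hc : Continuous fun φ => g ((1 + Real.cos φ) / 2)) :
    ∫ φ in (0 : ℝ)..2 * Real.pi, g ((1 + Real.cos φ) / 2) =
      2 * ∫ t in (0 : ℝ)..1, t ^ (-(1 / 2) : ℝ) * (1 - t) ^ (-(1 / 2) : ℝ) * g t := by
  have hper : Function.Periodic (fun φ => g ((1 + Real.cos φ) / 2)) (2 * Real.pi) := fun φ => by
    simp
  have h1 : ∫ φ in (0 : ℝ)..2 * Real.pi, g ((1 + Real.cos φ) / 2) =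
      2 * ∫ φ in (0 : ℝ)..Real.pi, g ((1 + Real.cos φ) / 2) := by
    have h := hper.intervalIntegral_add_eq 0 (-Real.pi)
    rw [zero_add, show -Real.pi + 2 * Real.pi = Real.pi by ring] at h
    rw [h, ← intervalIntegral.integral_add_adjacent_intervals (b := 0) (hc.intervalIntegrable _ _)
      (hc.intervalIntegrable _ _)]
    have h2 := intervalIntegral.integral_comp_neg (a := 0) (b := Real.pi)
      (fun φ => g ((1 + Real.cos φ) / 2))
    simp only [Real.cos_neg, neg_zero] at h2
    rw [← h2]; ring
  have himage : (fun φ => (1 + Real.cos φ) / 2) '' Set.Ioo 0 Real.pi = Set.Ioo 0 1 := by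
    ext t
    constructor
    · rintro ⟨φ, hφ, rfl⟩
      have h2 := Real.cos_lt_cos_of_nonneg_of_le_pi le_rfl hφ.2.le hφ.1
      have h3 := Real.cos_lt_cos_of_nonneg_of_le_pi hφ.1.le le_rfl hφ.2
      rw [Real.cos_zero] at h2
      rw [Real.cos_pi] at h3
      constructor <;> dsimp only <;> linarith
    · intro ht
      refine ⟨Real.arccos (2 * t - 1), ⟨Real.arccos_pos.2 (by linarith [ht.2]), ?_⟩, ?_⟩
      · refine lt_of_le_of_ne (Real.arccos_le_pi _) fun h => ?_
        rw [Real.arccos_eq_pi] at h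
        linarith [ht.1]
      · dsimp only
        rw [Real.cos_arccos (by linarith [ht.1]) (by linarith [ht.2])]; ring
  have hinj : Set.InjOn (fun φ => (1 + Real.cos φ) / 2) (Set.Ioo 0 Real.pi) := fun x hx y hy h =>
    Real.injOn_cos (Set.Ioo_subset_Icc_self hx) (Set.Ioo_subset_Icc_self hy) (by
      dsimp only at h; linarith)
  have hderiv : ∀ φ ∈ Set.Ioo 0 Real.pi, HasDerivWithinAt (fun φ => (1 + Real.cos φ) / 2)
      (-Real.sin φ / 2) (Set.Ioo 0 Real.pi) φ := fun φ _ =>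
    (((Real.hasDerivAt_cos φ).const_add 1).div_const 2).hasDerivWithinAt
  have hsub := integral_image_eq_integral_abs_deriv_smul measurableSet_Ioo hderiv hinj
    fun t => t ^ (-(1 / 2) : ℝ) * (1 - t) ^ (-(1 / 2) : ℝ) * g t
  rw [himage] at hsub
  rw [h1, intervalIntegral.integral_of_le zero_le_one, integral_Ioc_eq_integral_Ioo, hsub,
    intervalIntegral.integral_of_le Real.pi_pos.le, integral_Ioc_eq_integral_Ioo]
  congr 1
  refine setIntegral_congr_fun measurableSet_Ioo fun φ hφ => ?_
  have hsin := Real.sin_pos_of_mem_Ioo hφ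
  have hmem : (1 + Real.cos φ) / 2 ∈ Set.Ioo (0 : ℝ) 1 := himage ▸ Set.mem_image_of_mem _ hφ
  have hprod : (1 + Real.cos φ) / 2 * (1 - (1 + Real.cos φ) / 2) = (Real.sin φ / 2) ^ 2 := by
    rw [div_pow, Real.sin_sq]; ring
  rw [← Real.mul_rpow hmem.1.le (by linarith [hmem.2]), hprod, ← Real.rpow_natCast,
    ← Real.rpow_mul (by positivity), smul_eq_mul, neg_div, abs_neg,
    abs_of_pos (by positivity)]
  norm_num
  rw [Real.rpow_neg_one]
  field_simp

theorem phase_average_eq_gaussHypergeometric (a : ℝ) (q : ℕ) {x : ℝ} (hx : x < 1) :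
    (2 * Real.pi)⁻¹ * ∫ φ in (0 : ℝ)..2 * Real.pi,
        ((1 + Real.cos φ) / 2) ^ q * (1 - (1 + Real.cos φ) / 2 * x) ^ (-a) =
      Real.Gamma (1 / 2 + q) / (√Real.pi * Real.Gamma (q + 1)) *
        gaussHypergeometric a (1 / 2 + q) (q + 1) x := by
  have hpos : ∀ φ, 0 < 1 - (1 + Real.cos φ) / 2 * x := fun φ => by
    have h1 := Real.cos_le_one φ
    have h2 := Real.neg_one_le_cos φ
    rcases le_total x 0 with h | h <;> nlinarith
  rw [integral_comp_cos_sq_half (g := fun t => t ^ q * (1 - t * x) ^ (-a)), gaussHypergeometric]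
  · have h1 : Real.Gamma (1 / 2 + q) ≠ 0 := (Real.Gamma_pos_of_pos (by positivity)).ne'
    have h2 : Real.Gamma (q + 1) ≠ 0 := (Real.Gamma_pos_of_pos (by positivity)).ne'
    have h3 : √Real.pi * √Real.pi = Real.pi := Real.mul_self_sqrt Real.pi_pos.le
    have h4 : √Real.pi ≠ 0 := by positivity
    rw [show (q : ℝ) + 1 - (1 / 2 + q) = 1 / 2 by ring, Real.Gamma_one_half_eq]
    have hint : ∫ t in (0 : ℝ)..1, t ^ (-(1 / 2) : ℝ) * (1 - t) ^ (-(1 / 2) : ℝ) *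
          (t ^ q * (1 - t * x) ^ (-a)) =
        ∫ t in (0 : ℝ)..1, t ^ (1 / 2 + q - 1 : ℝ) * (1 - t) ^ (1 / 2 - 1 : ℝ) *
          (1 - t * x) ^ (-a) := by
      simp only [intervalIntegral.integral_of_le zero_le_one]
      refine setIntegral_congr_fun measurableSet_Ioc fun t ht => ?_
      rw [show (1 / 2 + q - 1 : ℝ) = -(1 / 2) + q by ring, Real.rpow_add ht.1, Real.rpow_natCast,
        show (1 / 2 - 1 : ℝ) = -(1 / 2) by norm_num]
      ring
    rw [hint]
    generalize ∫ t in (0 : ℝ)..1, t ^ (1 / 2 + q - 1 : ℝ) * (1 - t) ^ (1 / 2 - 1 : ℝ) *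
          (1 - t * x) ^ (-a) = I
    -- One `√π` matches the explicit prefactor, the other `Γ(1/2)` from the Euler integral.
    nth_rewrite 1 [← h3]
    field_simp
  · exact (by fun_prop : Continuous fun φ => ((1 + Real.cos φ) / 2) ^ q).mul
      (Continuous.rpow_const (by fun_prop) fun φ => Or.inl (hpos φ).ne')

/-! ### The fluctuating two-ray law -/

/-- The in-phase part of the specular component. -/
def specularRe (V₁ V₂ ζ φ₁ φ₂ : ℝ) : ℝ := √ζ * (V₁ * Real.cos φ₁ + V₂ * Real.cos φ₂)

/-- The quadrature part of the specular component. -/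
def specularIm (V₁ V₂ ζ φ₁ φ₂ : ℝ) : ℝ := √ζ * (V₁ * Real.sin φ₁ + V₂ * Real.sin φ₂)

theorem norm_twoRaySignal_sq (V₁ V₂ ζ φ₁ φ₂ : ℝ) (p : ℝ × ℝ) :
    ‖twoRaySignal V₁ V₂ ζ φ₁ φ₂ p.1 p.2‖ ^ 2 =
      shiftedSqNorm (specularRe V₁ V₂ ζ φ₁ φ₂) (specularIm V₁ V₂ ζ φ₁ φ₂) p := by
  rw [Complex.sq_norm, Complex.normSq_apply, twoRaySignal, shiftedSqNorm, specularRe, specularIm]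
  simp only [Complex.add_re, Complex.add_im, Complex.mul_re, Complex.mul_im, Complex.ofReal_re,
    Complex.ofReal_im, Complex.exp_ofReal_mul_I_re, Complex.exp_ofReal_mul_I_im, Complex.I_re,
    Complex.I_im]
  ring

theorem specular_sq_add_sq (V₁ V₂ φ₁ φ₂ : ℝ) {ζ : ℝ} (hζ : 0 ≤ ζ) :
    specularRe V₁ V₂ ζ φ₁ φ₂ ^ 2 + specularIm V₁ V₂ ζ φ₁ φ₂ ^ 2 =
      ζ * (V₁ ^ 2 + V₂ ^ 2 + 2 * V₁ * V₂ * Real.cos (φ₁ - φ₂)) := by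
  rw [specularRe, specularIm, mul_pow, mul_pow, Real.sq_sqrt hζ, Real.cos_sub]
  linear_combination ζ * V₁ ^ 2 * Real.sin_sq_add_cos_sq φ₁ +
    ζ * V₂ ^ 2 * Real.sin_sq_add_cos_sq φ₂

theorem measurable_twoRayPower (V₁ V₂ : ℝ) : Measurable fun w : ℝ × ℝ × ℝ × ℝ × ℝ =>
    ‖twoRaySignal V₁ V₂ w.1 w.2.1 w.2.2.1 w.2.2.2.1 w.2.2.2.2‖ ^ 2 := by
  unfold twoRaySignal
  fun_prop

theorem lintegral_twoRayPowerLaw {m : ℝ} (hm : 0 < m) (V₁ V₂ σ : ℝ) {f : ℝ → ENNReal}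
    (hf : Measurable f) :
    ∫⁻ x, f x ∂twoRayPowerLaw m V₁ V₂ σ =
      ∫⁻ ζ, ∫⁻ φ₁, ∫⁻ φ₂, ∫⁻ p, f (shiftedSqNorm (specularRe V₁ V₂ ζ φ₁ φ₂)
        (specularIm V₁ V₂ ζ φ₁ φ₂) p)
        ∂((gaussianReal 0 (σ ^ 2).toNNReal).prod (gaussianReal 0 (σ ^ 2).toNNReal))
        ∂uniformPhase ∂uniformPhase ∂gammaMeasure m m := by
  have := isProbabilityMeasure_gammaMeasure hm hm
  have hF := hf.comp (measurable_twoRayPower V₁ V₂)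
  rw [twoRayPowerLaw, twoRayInputLaw, lintegral_map hf (measurable_twoRayPower V₁ V₂)]
  refine (lintegral_prod _ hF.aemeasurable).trans (lintegral_congr fun ζ => ?_)
  have hF₁ := hF.comp (measurable_prodMk_left (x := ζ))
  refine (lintegral_prod _ hF₁.aemeasurable).trans (lintegral_congr fun φ₁ => ?_)
  have hF₂ := hF₁.comp (measurable_prodMk_left (x := φ₁))
  refine (lintegral_prod _ hF₂.aemeasurable).trans
    (lintegral_congr fun φ₂ => lintegral_congr fun p => ?_)
  rw [← norm_twoRaySignal_sq]
  rfl

/-- The preimage is covered by the point `-a` and two isometric copies of the square root of `(N -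
b) ∩ (0, ∞)`. The square root is differentiable on the positive axis, hence preserves null sets
there. -/
theorem volume_preimage_sq_add_eq_zero {N : Set ℝ} (hN : volume N = 0) (a b : ℝ) :
    volume ((fun x => (a + x) ^ 2 + b) ⁻¹' N) = 0 := by
  have h1 : volume ((fun x => x - b) '' N) = 0 := by
    rw [show (fun x : ℝ => x - b) = fun x => x + (-b) from rfl, Set.image_add_right, neg_neg,
      measure_preimage_add_right, hN]
  have h2 : volume (Real.sqrt '' (((fun x => x - b) '' N) ∩ Set.Ioi 0)) = 0 := by
    refine addHaar_image_eq_zero_of_differentiableOn_of_addHaar_eq_zero volume ?_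
      (measure_mono_null Set.inter_subset_left h1)
    exact fun x hx => (Real.hasDerivAt_sqrt hx.2.ne').differentiableAt.differentiableWithinAt
  set S := Real.sqrt '' (((fun x => x - b) '' N) ∩ Set.Ioi 0)
  have h3 : volume ((fun x => a + x) ⁻¹' S) = 0 := by rw [measure_preimage_add, h2]
  have h4 : volume ((fun x => -a - x) ⁻¹' S) = 0 :=
    (Measure.measurePreserving_sub_left volume (-a)).quasiMeasurePreserving.preimage_null h2
  refine measure_mono_null (t := {-a} ∪ ((fun x => a + x) ⁻¹' S ∪ (fun x => -a - x) ⁻¹' S))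
    (fun x hx => ?_) (measure_union_null (by simp) (measure_union_null h3 h4))
  have hmem : a + x ≠ 0 → |a + x| ∈ S := fun h0 =>
    ⟨(a + x) ^ 2, ⟨⟨_, hx, by ring⟩, by simpa using sq_pos_of_ne_zero h0⟩, Real.sqrt_sq_eq_abs _⟩
  by_cases h0 : a + x = 0
  · left; simp; linarith
  · right
    rcases le_total 0 (a + x) with h | h
    · left; simpa [abs_of_nonneg h] using hmem h0
    · right
      have := hmem h0
      rw [abs_of_nonpos h] at this
      rw [Set.mem_preimage]
      convert this using 1
      ring

/-- With everything except `X` fixed, the power is a shifted square of a Gaussian variable plus a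
constant, so null sets already have probability zero conditionally. This makes `pdf` a genuine
density of `V`. -/
theorem twoRayPowerLaw_absolutelyContinuous {m σ : ℝ} (hm : 0 < m) (hσ : 0 < σ) (V₁ V₂ : ℝ) :
    twoRayPowerLaw m V₁ V₂ σ ≪ volume := by
  refine Measure.AbsolutelyContinuous.mk fun N hN h0 => ?_
  have hv : (σ ^ 2).toNNReal ≠ 0 := by simp; positivity
  rw [← lintegral_indicator_one hN, lintegral_twoRayPowerLaw hm V₁ V₂ σ (measurable_one.indicator hN)]
  have key : ∀ a b : ℝ, ∫⁻ p, N.indicator 1 (shiftedSqNorm a b p)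
      ∂((gaussianReal 0 (σ ^ 2).toNNReal).prod (gaussianReal 0 (σ ^ 2).toNNReal)) =
      (0 : ENNReal) := fun a b => by
    have hmeas : Measurable (shiftedSqNorm a b) := by unfold shiftedSqNorm; fun_prop
    refine (lintegral_prod_symm _
      ((measurable_one.indicator hN).comp hmeas).aemeasurable).trans ?_
    refine lintegral_eq_zero_of_ae_eq_zero (Filter.Eventually.of_forall fun y => ?_)
    have : (fun x => N.indicator (1 : ℝ → ENNReal) (shiftedSqNorm a b (x, y))) =
        ((fun x => (a + x) ^ 2 + (b + y) ^ 2) ⁻¹' N).indicator 1 := rfl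
    simp only [Function.comp_def, Pi.zero_apply]
    rw [this, lintegral_indicator_one (hN.preimage (by fun_prop))]
    exact gaussianReal_absolutelyContinuous 0 hv (volume_preimage_sq_add_eq_zero h0 _ _)
  simp [key]

theorem twoRayPowerLaw_Iic_zero {m σ : ℝ} (hm : 0 < m) (hσ : 0 < σ) (V₁ V₂ : ℝ) :
    twoRayPowerLaw m V₁ V₂ σ (Set.Iic 0) = 0 := by
  rw [← Set.Iio_union_right, measure_union_null_iff]
  refine ⟨?_, twoRayPowerLaw_absolutelyContinuous hm hσ V₁ V₂ (by simp)⟩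
  rw [twoRayPowerLaw, Measure.map_apply (measurable_twoRayPower V₁ V₂) measurableSet_Iio]
  convert measure_empty (μ := twoRayInputLaw m σ)
  ext w
  simp

/-! ### The generalized moment generating function of the fluctuating two-ray law -/

theorem noncentralGMGF_nonneg {c r s : ℝ} (hc : 0 < c) (hr : 0 ≤ r) (hs : c * s < 1) (n : ℕ) :
    0 ≤ noncentralGMGF c r n s := by
  have : 0 < 1 - c * s := by linarith
  unfold noncentralGMGF
  positivity

theorem continuous_noncentralGMGF (c s : ℝ) (n : ℕ) :
    Continuous fun r => noncentralGMGF c r n s := by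
  unfold noncentralGMGF
  fun_prop

/-- Separates the dependence on `ζ` into functions `ζ ^ l * exp (-k ζ)` with known gamma averages.
Here `u` plays the role of `1 + Δ cos φ`. -/
theorem noncentralGMGF_mul_eq_sum (c K u s : ℝ) (hc : 0 < c) (n : ℕ) (ζ : ℝ) :
    noncentralGMGF c (ζ * (c * K * u)) n s =
      ∑ l ∈ Finset.range (n + 1), n.factorial * c ^ n * ((1 - c * s)⁻¹) ^ (n + 1) *
        ((n.choose l : ℝ) / l.factorial * (K * u / (1 - c * s)) ^ l) *
        (ζ ^ l * Real.exp (-(-(s * (c * K * u) / (1 - c * s)) * ζ))) := by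
  rw [noncentralGMGF, Finset.mul_sum]
  refine Finset.sum_congr rfl fun l _ => ?_
  rw [show ζ * (c * K * u) / (c * (1 - c * s)) = K * u / (1 - c * s) * ζ by
      rw [mul_comm c (1 - c * s), ← div_div]; field_simp,
    show -(-(s * (c * K * u) / (1 - c * s)) * ζ) = s * (ζ * (c * K * u)) / (1 - c * s) by ring,
    mul_pow]
  ring

theorem lintegral_noncentralGMGF_gammaMeasure {m c K u s : ℝ} (hm : 0 < m) (hc : 0 < c)
    (hK : 0 ≤ K) (hu : 0 ≤ u) (hs : s ≤ 0) (n : ℕ) :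
    ∫⁻ ζ, ENNReal.ofReal (noncentralGMGF c (ζ * (c * K * u)) n s) ∂gammaMeasure m m =
      ENNReal.ofReal (n.factorial * c ^ n * ((1 - c * s)⁻¹) ^ (n + 1) *
        ∑ l ∈ Finset.range (n + 1), (n.choose l : ℝ) / l.factorial * (K * u / (1 - c * s)) ^ l *
          (m ^ m * (ascPochhammer ℝ l).eval m /
            (m + -(s * (c * K * u) / (1 - c * s))) ^ (m + l))) := by
  have hcs : c * s ≤ 0 := mul_nonpos_of_nonneg_of_nonpos hc.le hs
  have hw : 0 < 1 - c * s := by linarith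
  have hk : 0 ≤ -(s * (c * K * u) / (1 - c * s)) := by
    rw [← neg_div, ← neg_mul]
    have := neg_nonneg.2 hs
    positivity
  rw [← ofReal_integral_eq_lintegral_ofReal]
  · simp only [noncentralGMGF_mul_eq_sum c K u s hc n]
    rw [integral_finsetSum _ fun l _ => (integrable_pow_mul_exp_gammaMeasure hm hk l).const_mul _]
    simp only [integral_const_mul, integral_pow_mul_exp_gammaMeasure hm hk, Finset.mul_sum]
    congr 1
    exact Finset.sum_congr rfl fun l _ => by ring
  · simp only [noncentralGMGF_mul_eq_sum c K u s hc n]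
    exact integrable_finsetSum _ fun l _ => (integrable_pow_mul_exp_gammaMeasure hm hk l).const_mul _
  · filter_upwards [ae_pos_gammaMeasure m m] with ζ hζ
    exact noncentralGMGF_nonneg hc (by positivity) (by linarith) n

/-- Tonelli reduction of the generalized moment generating function to an average over the phase
difference of the two specular components. -/
theorem lintegral_pow_mul_exp_twoRayPowerLaw {m V₁ V₂ σ s : ℝ} (hm : 0 < m) (hσ : 0 < σ)
    (hs : s ≤ 0) (n : ℕ) :
    ∫⁻ x, ENNReal.ofReal (x ^ n * Real.exp (s * x)) ∂twoRayPowerLaw m V₁ V₂ σ =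
      ∫⁻ φ, ∫⁻ ζ, ENNReal.ofReal (noncentralGMGF (2 * σ ^ 2)
        (ζ * (V₁ ^ 2 + V₂ ^ 2 + 2 * V₁ * V₂ * Real.cos φ)) n s) ∂gammaMeasure m m
        ∂uniformPhase := by
  have := isProbabilityMeasure_gammaMeasure hm hm
  have hv : (σ ^ 2).toNNReal ≠ 0 := by simp; positivity
  have hv' : ((σ ^ 2).toNNReal : ℝ) = σ ^ 2 := Real.coe_toNNReal _ (by positivity)
  have hc : 0 < 2 * σ ^ 2 := by positivity
  have hcs : 2 * σ ^ 2 * s < 1 := by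
    linarith [mul_nonpos_of_nonneg_of_nonpos hc.le hs]
  have hcont := continuous_noncentralGMGF (2 * σ ^ 2) s n
  have hr : ∀ φ, 0 ≤ V₁ ^ 2 + V₂ ^ 2 + 2 * V₁ * V₂ * Real.cos φ := fun φ => by
    nlinarith [sq_nonneg (V₁ + V₂ * Real.cos φ), Real.sin_sq_add_cos_sq φ,
      sq_nonneg (V₂ * Real.sin φ)]
  rw [lintegral_twoRayPowerLaw hm V₁ V₂ σ (by fun_prop)]
  refine Eq.trans ?_ (lintegral_lintegral_swap ?_)
  · refine lintegral_congr_ae ?_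
    filter_upwards [ae_pos_gammaMeasure m m] with ζ hζ
    rw [← lintegral_lintegral_uniformPhase_sub (h := fun φ => noncentralGMGF (2 * σ ^ 2)
      (ζ * (V₁ ^ 2 + V₂ ^ 2 + 2 * V₁ * V₂ * Real.cos φ)) n s) (hcont.comp (by fun_prop))
      (fun φ => noncentralGMGF_nonneg hc (mul_nonneg hζ (hr φ)) hcs n) (fun φ => by simp)]
    refine lintegral_congr fun φ₁ => lintegral_congr fun φ₂ => ?_
    rw [lintegral_pow_mul_exp_shiftedSqNorm hv _ _ n (by rwa [hv']), hv',
      specular_sq_add_sq _ _ _ _ hζ]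
  · exact (ENNReal.measurable_ofReal.comp (hcont.comp (by fun_prop : Continuous fun p : ℝ × ℝ =>
      p.1 * (V₁ ^ 2 + V₂ ^ 2 + 2 * V₁ * V₂ * Real.cos p.2))).measurable).aemeasurable

/-- The conditional generalized moment generating function of the fluctuating two-ray law, given
that the phase difference `φ` has `cos φ = 2 τ - 1`, with the powers of `1 + Δ cos φ` expanded
around `1 - Δ`. -/
def ftrPhaseGMGF (m K Δ : ℝ) (n : ℕ) (s τ : ℝ) : ℝ :=
  n.factorial * m ^ m * (1 + K - s) ^ (m - n - 1) *
    ∑ l ∈ Finset.range (n + 1),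
      (n.choose l : ℝ) * ((ascPochhammer ℝ l).eval m / l.factorial) *
      ((1 + K) ^ (l + 1) * K ^ l / (m * (1 + K) - (m + K - K * Δ) * s) ^ (m + l)) *
      ∑ q ∈ Finset.range (l + 1),
        (l.choose q : ℝ) * (1 - Δ) ^ (l - q) * (2 * Δ) ^ q *
        (τ ^ q * (1 - τ * (2 * K * Δ * s / (m * (1 + K) - (m + K - K * Δ) * s))) ^ (-(m + l)))

theorem ftrDenominator_pos {m K Δ s : ℝ} (hm : 0 < m) (hK : 0 ≤ K) (hΔ1 : Δ ≤ 1) (hs : s ≤ 0) :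
    0 < m * (1 + K) - (m + K - K * Δ) * s := by
  have : 0 ≤ m + K - K * Δ := by nlinarith
  nlinarith [mul_nonneg this (neg_nonneg.2 hs), mul_pos hm (by linarith : 0 < 1 + K)]

theorem hypergeometric_argument_nonpos {m K Δ s : ℝ} (hm : 0 < m) (hK : 0 ≤ K) (hΔ0 : 0 ≤ Δ)
    (hΔ1 : Δ ≤ 1) (hs : s ≤ 0) :
    2 * K * Δ * s / (m * (1 + K) - (m + K - K * Δ) * s) ≤ 0 :=
  div_nonpos_of_nonpos_of_nonneg (mul_nonpos_of_nonneg_of_nonpos (by positivity) hs)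
    (ftrDenominator_pos hm hK hΔ1 hs).le

/-- The gamma average leaves a real power of a quantity affine in `τ`; it factors as `D (1 - τ x) /
(1 + K - s)` with `x` the hypergeometric argument (`hE`). The binomial theorem for `u ^ l` does the
rest. -/
theorem ftrPhaseGMGF_eq {m K Δ s τ : ℝ} (hm : 0 < m) (hK : 0 ≤ K) (hΔ0 : 0 ≤ Δ) (hΔ1 : Δ ≤ 1)
    (hs : s ≤ 0) (hτ : 0 ≤ τ) (n : ℕ) {c u : ℝ} (hc : c = (1 + K)⁻¹)
    (hu : u = 2 * Δ * τ + (1 - Δ)) :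
    n.factorial * c ^ n * ((1 - c * s)⁻¹) ^ (n + 1) *
        ∑ l ∈ Finset.range (n + 1), (n.choose l : ℝ) / l.factorial * (K * u / (1 - c * s)) ^ l *
          (m ^ m * (ascPochhammer ℝ l).eval m /
            (m + -(s * (c * K * u) / (1 - c * s))) ^ (m + l)) =
      ftrPhaseGMGF m K Δ n s τ := by
  set D := m * (1 + K) - (m + K - K * Δ) * s with hD
  set x := 2 * K * Δ * s / D with hx
  have hD0 : 0 < D := ftrDenominator_pos hm hK hΔ1 hs
  have hx0 : x ≤ 0 := hypergeometric_argument_nonpos hm hK hΔ0 hΔ1 hs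
  have hτx : 0 < 1 - τ * x := by nlinarith [mul_nonneg hτ (neg_nonneg.2 hx0)]
  have hK1 : 0 < 1 + K := by linarith
  have hQ : 0 < 1 + K - s := by linarith
  have hwQ : 1 - c * s = (1 + K - s) / (1 + K) := by rw [hc]; field_simp
  have hE : m + -(s * (c * K * u) / (1 - c * s)) = D * (1 - τ * x) / (1 + K - s) := by
    rw [hwQ, hx, hc, hu]
    field_simp
    rw [hD]
    ring
  rw [ftrPhaseGMGF, Finset.mul_sum, Finset.mul_sum]
  refine Finset.sum_congr rfl fun l _ => ?_
  have hbin : ∑ q ∈ Finset.range (l + 1), (l.choose q : ℝ) * (1 - Δ) ^ (l - q) * (2 * Δ) ^ q *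
      (τ ^ q * (1 - τ * x) ^ (-(m + l))) = u ^ l * (1 - τ * x) ^ (-(m + l)) := by
    rw [hu, add_pow, Finset.sum_mul]
    refine Finset.sum_congr rfl fun q _ => ?_
    rw [mul_pow (2 * Δ)]
    ring
  rw [hbin, hE, hwQ, hc, Real.div_rpow (by positivity) hQ.le, Real.mul_rpow hD0.le hτx.le,
    Real.rpow_neg hτx.le, show m - n - 1 = m - (n + 1 : ℕ) by push_cast; ring,
    Real.rpow_sub_natCast hQ.ne', Real.rpow_add_natCast hQ.ne']
  have h1 : 0 < (1 - τ * x) ^ (m + l) := by positivity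
  have h2 : 0 < D ^ (m + l) := by positivity
  have h3 : 0 < (1 + K - s) ^ m := by positivity
  -- With the natural exponents split off, the real powers become opaque positive numbers and a
  -- rational identity remains.
  generalize (1 - τ * x) ^ (m + l) = a at *
  generalize D ^ (m + l) = b at *
  generalize (1 + K - s) ^ m = d at *
  have h4 : (l.factorial : ℝ) ≠ 0 := by positivity
  rw [inv_div, inv_pow, div_div_eq_mul_div, div_pow, div_pow, mul_pow, mul_pow]
  field_simp
  ring

theorem continuous_ftrPhaseGMGF {m K Δ s : ℝ} (hm : 0 < m) (hK : 0 ≤ K) (hΔ0 : 0 ≤ Δ)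
    (hΔ1 : Δ ≤ 1) (hs : s ≤ 0) (n : ℕ) :
    Continuous fun φ => ftrPhaseGMGF m K Δ n s ((1 + Real.cos φ) / 2) := by
  have hx0 := hypergeometric_argument_nonpos hm hK hΔ0 hΔ1 hs
  unfold ftrPhaseGMGF
  refine continuous_const.mul (continuous_finsetSum _ fun l _ => continuous_const.mul
    (continuous_finsetSum _ fun q _ => continuous_const.mul ((by fun_prop : Continuous fun φ =>
      ((1 + Real.cos φ) / 2) ^ q).mul (Continuous.rpow_const (by fun_prop) fun φ => Or.inl ?_))))
  have := Real.neg_one_le_cos φ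
  nlinarith [mul_nonneg (by linarith : 0 ≤ (1 + Real.cos φ) / 2) (neg_nonneg.2 hx0)]

theorem ftrPhaseGMGF_nonneg {m K Δ s τ : ℝ} (hm : 0 < m) (hK : 0 ≤ K) (hΔ0 : 0 ≤ Δ) (hΔ1 : Δ ≤ 1)
    (hs : s ≤ 0) (hτ : 0 ≤ τ) (n : ℕ) : 0 ≤ ftrPhaseGMGF m K Δ n s τ := by
  have hD0 := ftrDenominator_pos hm hK hΔ1 hs
  have hx0 := hypergeometric_argument_nonpos hm hK hΔ0 hΔ1 hs
  have hτx := mul_nonpos_of_nonneg_of_nonpos hτ hx0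
  have hΔ : 0 ≤ 1 - Δ := by linarith
  have hQ : 0 ≤ 1 + K - s := by linarith
  refine mul_nonneg (by positivity) (Finset.sum_nonneg fun l _ =>
    mul_nonneg ?_ (Finset.sum_nonneg fun q _ => mul_nonneg (by positivity)
      (mul_nonneg (by positivity) (Real.rpow_nonneg (by linarith) _))))
  have := ascPochhammer_pos l m hm
  positivity

theorem phase_average_ftrPhaseGMGF {m K Δ s : ℝ} (hm : 0 < m) (hK : 0 ≤ K) (hΔ0 : 0 ≤ Δ)
    (hΔ1 : Δ ≤ 1) (hs : s ≤ 0) (n : ℕ) :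
    (2 * Real.pi)⁻¹ * ∫ φ in (0 : ℝ)..2 * Real.pi, ftrPhaseGMGF m K Δ n s ((1 + Real.cos φ) / 2) =
      ftrGMGF 1 m K Δ n s := by
  have hx0 := hypergeometric_argument_nonpos hm hK hΔ0 hΔ1 hs
  have hcont : ∀ l q : ℕ, Continuous fun φ => ((1 + Real.cos φ) / 2) ^ q *
      (1 - (1 + Real.cos φ) / 2 * (2 * K * Δ * s / (m * (1 + K) - (m + K - K * Δ) * s))) ^
        (-(m + l)) := fun l q => by
    refine (by fun_prop : Continuous fun φ => ((1 + Real.cos φ) / 2) ^ q).mul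
      (Continuous.rpow_const (by fun_prop) fun φ => Or.inl ?_)
    have := Real.neg_one_le_cos φ
    nlinarith [mul_nonneg (by linarith : 0 ≤ (1 + Real.cos φ) / 2) (neg_nonneg.2 hx0)]
  simp only [ftrPhaseGMGF, ftrGMGF, mul_one, one_mul, one_pow]
  rw [intervalIntegral.integral_const_mul, intervalIntegral.integral_finsetSum, mul_left_comm,
    Finset.mul_sum]
  swap
  · exact fun l _ => Continuous.intervalIntegrable (continuous_const.mul
      (continuous_finsetSum _ fun q _ => continuous_const.mul (hcont l q))) _ _
  congr 1
  refine Finset.sum_congr rfl fun l _ => ?_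
  rw [intervalIntegral.integral_const_mul, intervalIntegral.integral_finsetSum, mul_left_comm,
    Finset.mul_sum]
  swap
  · exact fun q _ => Continuous.intervalIntegrable (continuous_const.mul (hcont l q)) _ _
  congr 1
  refine Finset.sum_congr rfl fun q _ => ?_
  rw [intervalIntegral.integral_const_mul, mul_left_comm,
    phase_average_eq_gaussHypergeometric _ q (by linarith), mul_assoc (_ * _ * _)]

/-- Unit mean power turns the physical parameters into `2σ² = (1 + K)⁻¹` and the specular power into
`2σ² K (1 + Δ cos φ)`. Nonnegativity is recorded so that `ENNReal.ofReal` can later be undone. -/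
theorem lintegral_pow_mul_exp_eq_ftrGMGF {m K Δ V₁ V₂ σ s : ℝ} (hm : 0 < m) (hV₁ : 0 ≤ V₁)
    (hV₂ : 0 ≤ V₂) (hσ : 0 < σ) (hK : K = (V₁ ^ 2 + V₂ ^ 2) / (2 * σ ^ 2))
    (hΔ : Δ = 2 * V₁ * V₂ / (V₁ ^ 2 + V₂ ^ 2)) (hγ : 1 = V₁ ^ 2 + V₂ ^ 2 + 2 * σ ^ 2)
    (hs : s ≤ 0) (n : ℕ) :
    ∫⁻ x, ENNReal.ofReal (x ^ n * Real.exp (s * x)) ∂twoRayPowerLaw m V₁ V₂ σ =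
      ENNReal.ofReal (ftrGMGF 1 m K Δ n s) ∧ 0 ≤ ftrGMGF 1 m K Δ n s := by
  have hK0 : 0 ≤ K := by rw [hK]; positivity
  have hΔ0 : 0 ≤ Δ := by rw [hΔ]; positivity
  have hΔ1 : Δ ≤ 1 := by
    rw [hΔ]
    exact div_le_one_of_le₀ (by nlinarith [sq_nonneg (V₁ - V₂)]) (by positivity)
  have hc0 : 0 < 2 * σ ^ 2 := by positivity
  have hc : 2 * σ ^ 2 = (1 + K)⁻¹ := by
    rw [hK, one_add_div hc0.ne', inv_div, show 2 * σ ^ 2 + (V₁ ^ 2 + V₂ ^ 2) = 1 by linarith, div_one]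
  have hsum : V₁ ^ 2 + V₂ ^ 2 = 2 * σ ^ 2 * K := by rw [hK]; field_simp
  have hprod : 2 * V₁ * V₂ = 2 * σ ^ 2 * K * Δ := by
    rw [← hsum, hΔ]
    -- Without specular components `Δ` is `0 / 0 = 0` and both sides vanish.
    by_cases h : V₁ ^ 2 + V₂ ^ 2 = 0
    · have : V₁ = 0 := by nlinarith [sq_nonneg V₁, sq_nonneg V₂]
      simp [this]
    · field_simp
  have hpow : ∀ φ, V₁ ^ 2 + V₂ ^ 2 + 2 * V₁ * V₂ * Real.cos φ =
      2 * σ ^ 2 * K * (1 + Δ * Real.cos φ) := fun φ => by rw [hprod, hsum]; ring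
  have hu : ∀ φ, 0 ≤ 1 + Δ * Real.cos φ := fun φ => by
    nlinarith [Real.neg_one_le_cos φ]
  have hcs : 0 < 1 - 2 * σ ^ 2 * s := by
    linarith [mul_nonpos_of_nonneg_of_nonpos hc0.le hs]
  rw [lintegral_pow_mul_exp_twoRayPowerLaw hm hσ hs n]
  have hJ : ∀ φ, ∫⁻ ζ, ENNReal.ofReal (noncentralGMGF (2 * σ ^ 2)
        (ζ * (V₁ ^ 2 + V₂ ^ 2 + 2 * V₁ * V₂ * Real.cos φ)) n s) ∂gammaMeasure m m =
      ENNReal.ofReal (ftrPhaseGMGF m K Δ n s ((1 + Real.cos φ) / 2)) := fun φ => by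
    rw [hpow, lintegral_noncentralGMGF_gammaMeasure hm hc0 hK0 (hu φ) hs n,
      ftrPhaseGMGF_eq (τ := (1 + Real.cos φ) / 2) hm hK0 hΔ0 hΔ1 hs
        (by linarith [Real.neg_one_le_cos φ]) n hc (by ring)]
  have h0 : ∀ φ, 0 ≤ ftrPhaseGMGF m K Δ n s ((1 + Real.cos φ) / 2) := fun φ =>
    ftrPhaseGMGF_nonneg hm hK0 hΔ0 hΔ1 hs (by linarith [Real.neg_one_le_cos φ]) n
  simp only [hJ]
  rw [← phase_average_ftrPhaseGMGF hm hK0 hΔ0 hΔ1 hs n]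
  exact ⟨lintegral_ofReal_uniformPhase (continuous_ftrPhaseGMGF hm hK0 hΔ0 hΔ1 hs n) h0,
    mul_nonneg (by positivity)
      (intervalIntegral.integral_nonneg (by positivity) fun φ _ => h0 φ)⟩

/-! ### The inverse gamma law -/

/-- The density of the inverse gamma law. -/
def inverseGammaPDFReal (lam β x : ℝ) : ℝ :=
  if 0 < x then β ^ lam / Real.Gamma lam * x ^ (-lam - 1) * Real.exp (-(β / x)) else 0

theorem inverseGammaMeasure_eq (lam β : ℝ) : inverseGammaMeasure lam β =
    volume.withDensity fun x => ENNReal.ofReal (inverseGammaPDFReal lam β x) := rfl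

theorem measurable_uncurry_inverseGammaPDFReal (lam : ℝ) :
    Measurable fun p : ℝ × ℝ => inverseGammaPDFReal lam p.1 p.2 :=
  Measurable.ite (measurableSet_lt measurable_const measurable_snd) (by fun_prop) measurable_const

theorem measurable_inverseGammaPDFReal (lam β : ℝ) : Measurable (inverseGammaPDFReal lam β) :=
  (measurable_uncurry_inverseGammaPDFReal lam).comp measurable_prodMk_left

theorem inverseGammaPDFReal_nonneg {lam β : ℝ} (hlam : 0 < lam) (hβ : 0 ≤ β) (x : ℝ) :
    0 ≤ inverseGammaPDFReal lam β x := by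
  have := Real.Gamma_pos_of_pos hlam
  unfold inverseGammaPDFReal
  split_ifs <;> positivity

theorem integral_inverseGammaMeasure {lam β : ℝ} (hlam : 0 < lam) (hβ : 0 ≤ β) :
    ∫ x, x ∂inverseGammaMeasure lam β =
      β ^ lam / Real.Gamma lam * ∫ x in Set.Ioi 0, x ^ (-lam) * Real.exp (-(β / x)) := by
  rw [inverseGammaMeasure_eq, integral_withDensity_eq_integral_toReal_smul
    (measurable_inverseGammaPDFReal lam β).ennreal_ofReal (by simp), ← integral_const_mul]
  simp only [ENNReal.toReal_ofReal (inverseGammaPDFReal_nonneg hlam hβ _), smul_eq_mul]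
  rw [← setIntegral_eq_integral_of_forall_compl_eq_zero (s := Set.Ioi 0)]
  · refine setIntegral_congr_fun measurableSet_Ioi fun x (hx : 0 < x) => ?_
    rw [inverseGammaPDFReal, if_pos hx, Real.rpow_sub_one hx.ne']
    field_simp
  · intro x hx
    rw [inverseGammaPDFReal, if_neg (show ¬0 < x from hx), zero_mul]

/-- A nonzero integral implies integrability. On `x > 1` the exponential is at least `exp (-β)`, so
`x ^ (-lam)` is integrable at infinity. -/
theorem one_lt_of_integral_ne_zero {lam β : ℝ} (hβ : 0 ≤ β)
    (h : ∫ x in Set.Ioi 0, x ^ (-lam) * Real.exp (-(β / x)) ≠ 0) : 1 < lam := by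
  have hint : IntegrableOn (fun x => x ^ (-lam) * Real.exp (-(β / x))) (Set.Ioi 1) :=
    (not_imp_comm.1 integral_undef h : IntegrableOn _ _ _).mono_set
      (Set.Ioi_subset_Ioi zero_le_one)
  have hpow : IntegrableOn (fun x : ℝ => x ^ (-lam)) (Set.Ioi 1) := by
    refine (hint.const_mul (Real.exp β)).mono' (by fun_prop)
      ((ae_restrict_iff' measurableSet_Ioi).2 (Filter.Eventually.of_forall fun x hx => ?_))
    have hx1 : (1 : ℝ) < x := hx
    have hx0 : 0 < x := by linarith
    rw [Real.norm_of_nonneg (by positivity), mul_left_comm, ← Real.exp_add]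
    refine le_mul_of_one_le_right (by positivity) (Real.one_le_exp ?_)
    have : β / x ≤ β := div_le_self hβ hx1.le
    linarith
  rw [integrableOn_Ioi_rpow_iff one_pos] at hpow
  linarith

theorem integral_rpow_neg_mul_exp_neg_div {lam β : ℝ} (hlam : 1 < lam) (hβ : 0 < β) :
    ∫ x in Set.Ioi 0, x ^ (-lam) * Real.exp (-(β / x)) =
      (1 / β) ^ (lam - 1) * Real.Gamma (lam - 1) := by
  rw [← Real.integral_rpow_mul_exp_neg_mul_Ioi (by linarith) hβ,
    ← integral_comp_rpow_Ioi (fun t => t ^ (lam - 1 - 1) * Real.exp (-(β * t)))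
      (by norm_num : (-1 : ℝ) ≠ 0)]
  refine setIntegral_congr_fun measurableSet_Ioi fun x (hx : 0 < x) => ?_
  have h1 : x ^ (-1 - 1 : ℝ) * x ^ (-1 * (lam - 1 - 1)) = x ^ (-lam) := by
    rw [← Real.rpow_add hx]; congr 1; ring
  simp only [smul_eq_mul, abs_neg, abs_one, one_mul]
  rw [← Real.rpow_mul hx.le, ← mul_assoc, h1, Real.rpow_neg_one, div_eq_mul_inv]

/-- The inversion `x ↦ x⁻¹` turns the mean into a gamma integral, and `Γ(lam) = (lam - 1) Γ(lam -
1)` reduces it to `β / (lam - 1)`. -/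
theorem inverseGamma_scale_of_mean_one {lam β : ℝ} (hlam : 0 < lam) (hβ : 0 < β)
    (h : ∫ x, x ∂inverseGammaMeasure lam β = 1) : 1 < lam ∧ β = lam - 1 := by
  rw [integral_inverseGammaMeasure hlam hβ.le] at h
  have h1 : 1 < lam := one_lt_of_integral_ne_zero hβ.le fun h0 => by simp [h0] at h
  refine ⟨h1, ?_⟩
  have hG : Real.Gamma (lam - 1) ≠ 0 := (Real.Gamma_pos_of_pos (by linarith)).ne'
  have hl : lam - 1 ≠ 0 := by linarith
  have hrec := Real.Gamma_add_one hl
  rw [sub_add_cancel] at hrec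
  rw [integral_rpow_neg_mul_exp_neg_div h1 hβ, hrec, one_div, Real.inv_rpow hβ.le,
    Real.rpow_sub_one hβ.ne'] at h
  have hb : β ^ lam ≠ 0 := by positivity
  field_simp at h
  exact h

theorem inverseGammaPDFReal_scale {lam β c x : ℝ} (hβ : 0 ≤ β) (hc : 0 < c) :
    c * inverseGammaPDFReal lam (c * β) (c * x) = inverseGammaPDFReal lam β x := by
  unfold inverseGammaPDFReal
  by_cases hx : 0 < x
  · rw [if_pos hx, if_pos (by positivity), mul_div_mul_left _ _ hc.ne', Real.mul_rpow hc.le hβ,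
      Real.mul_rpow hc.le hx.le, Real.rpow_sub_one hc.ne' (-lam), Real.rpow_neg hc.le]
    have : c ^ lam ≠ 0 := by positivity
    field_simp
  · rw [if_neg hx, if_neg (by rwa [mul_pos_iff_of_pos_left hc]), mul_zero]

/-- Scaling an inverse gamma variable. -/
theorem lintegral_comp_mul_inverseGammaMeasure {lam β c : ℝ} (hβ : 0 ≤ β) (hc : 0 < c)
    {f : ℝ → ENNReal} (hf : Measurable f) :
    ∫⁻ x, f (c * x) ∂inverseGammaMeasure lam β =
      ∫⁻ z, ENNReal.ofReal (inverseGammaPDFReal lam (c * β) z) * f z := by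
  have hm : Measurable fun z => ENNReal.ofReal (inverseGammaPDFReal lam (c * β) z) * f z :=
    (measurable_inverseGammaPDFReal lam (c * β)).ennreal_ofReal.mul hf
  have key : ∫⁻ z, ENNReal.ofReal (inverseGammaPDFReal lam (c * β) z) * f z =
      ENNReal.ofReal c *
        ∫⁻ x, ENNReal.ofReal (inverseGammaPDFReal lam (c * β) (c * x)) * f (c * x) := by
    conv_lhs => rw [← Real.smul_map_volume_mul_left hc.ne', lintegral_smul_measure,
      lintegral_map hm (measurable_const_mul c), smul_eq_mul, abs_of_pos hc]
  rw [inverseGammaMeasure_eq, lintegral_withDensity_eq_lintegral_mul _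
    (measurable_inverseGammaPDFReal lam β).ennreal_ofReal (g := fun x => f (c * x))
      (hf.comp (measurable_const_mul c)), key, ← lintegral_const_mul' _ _ ENNReal.ofReal_ne_top]
  refine lintegral_congr fun x => ?_
  rw [← mul_assoc, ← ENNReal.ofReal_mul hc.le, inverseGammaPDFReal_scale hβ hc]
  rfl

/-! ### The distribution function of the inverse gamma law of integer shape -/

/-- The probability that a Poisson variable of mean `t` is less than `N`. -/
def poissonCDFSum (N : ℕ) (t : ℝ) : ℝ :=
  ∑ n ∈ Finset.range N, t ^ n / n.factorial * Real.exp (-t)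

/-- The derivative telescopes: only the top Poisson weight survives. Composed with `t = β / x` it is
the inverse gamma density of shape `N + 1`. -/
theorem hasDerivAt_poissonCDFSum (N : ℕ) (t : ℝ) :
    HasDerivAt (poissonCDFSum (N + 1)) (-(t ^ N / N.factorial * Real.exp (-t))) t := by
  have hexp : HasDerivAt (fun t => Real.exp (-t)) (-Real.exp (-t)) t := by
    simpa using (hasDerivAt_neg t).exp
  induction N with
  | zero =>
    have : poissonCDFSum (0 + 1) = fun t => Real.exp (-t) := by funext t; simp [poissonCDFSum]
    rw [this]
    simpa using hexp
  | succ N ih =>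
    have hsucc : poissonCDFSum (N + 1 + 1) = fun t => poissonCDFSum (N + 1) t +
        t ^ (N + 1) / (N + 1).factorial * Real.exp (-t) := by
      funext t; rw [poissonCDFSum, Finset.sum_range_succ, ← poissonCDFSum]
    rw [hsucc]
    refine (ih.add (((hasDerivAt_pow (N + 1) t).div_const _).mul hexp)).congr_deriv ?_
    have h1 : (N.factorial : ℝ) ≠ 0 := by positivity
    rw [Nat.factorial_succ]
    push_cast
    field_simp
    ring

theorem tendsto_poissonCDFSum (N : ℕ) :
    Filter.Tendsto (poissonCDFSum N) Filter.atTop (nhds 0) := by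
  have : Filter.Tendsto (poissonCDFSum N) Filter.atTop
      (nhds (∑ n ∈ Finset.range N, ((n.factorial : ℝ)⁻¹ * 0))) := by
    refine tendsto_finsetSum _ fun n _ => ?_
    refine ((Real.tendsto_pow_mul_exp_neg_atTop_nhds_zero n).const_mul _).congr fun t => ?_
    ring
  simpa using this

theorem inverseGammaMeasure_Iic {N : ℕ} {β y : ℝ} (hβ : 0 < β) (hy : 0 < y)
    [IsFiniteMeasure (inverseGammaMeasure (N + 1 : ℕ) β)] :
    inverseGammaMeasure (N + 1 : ℕ) β (Set.Iic y) =
      ENNReal.ofReal (poissonCDFSum (N + 1) (β / y)) := by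
  have hN : (0 : ℝ) < (N + 1 : ℕ) := by positivity
  have h0 := inverseGammaPDFReal_nonneg hN hβ.le
  have hint : Integrable (inverseGammaPDFReal (N + 1 : ℕ) β) := by
    refine ⟨(measurable_inverseGammaPDFReal _ β).aestronglyMeasurable, ?_⟩
    rw [hasFiniteIntegral_iff_ofReal (Filter.Eventually.of_forall h0)]
    have := measure_lt_top (inverseGammaMeasure (N + 1 : ℕ) β) Set.univ
    rwa [inverseGammaMeasure_eq, withDensity_apply _ MeasurableSet.univ,
      Measure.restrict_univ] at this
  have hderiv : ∀ x, 0 < x → HasDerivAt (fun x => poissonCDFSum (N + 1) (β / x))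
      (inverseGammaPDFReal (N + 1 : ℕ) β x) x := fun x hx => by
    have hinv : HasDerivAt (fun x => β / x) (-(β / x ^ 2)) x := by
      simpa [div_eq_mul_inv] using (hasDerivAt_inv hx.ne').const_mul β
    refine ((hasDerivAt_poissonCDFSum N (β / x)).comp x hinv).congr_deriv ?_
    rw [inverseGammaPDFReal, if_pos hx, show (-((N + 1 : ℕ) : ℝ) - 1) = -((N + 2 : ℕ) : ℝ) by
      push_cast; ring, Real.rpow_neg hx.le, Real.rpow_natCast, Real.rpow_natCast, div_pow]
    push_cast
    rw [Real.Gamma_nat_eq_factorial]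
    field_simp
    ring
  -- Since `β / 0 = 0`, the antiderivative takes the value 1 at `x = 0`; the fundamental theorem
  -- therefore needs the one-sided limit 0 instead.
  have hzero : Filter.Tendsto (fun x => poissonCDFSum (N + 1) (β / x)) (nhdsWithin 0 (Set.Ioi 0))
      (nhds 0) :=
    (tendsto_poissonCDFSum (N + 1)).comp (tendsto_inv_nhdsGT_zero.const_mul_atTop hβ)
  have hFTC := intervalIntegral.integral_eq_sub_of_hasDerivAt_of_tendsto hy
    (fun x hx => hderiv x hx.1) hint.intervalIntegrable hzero
    ((hderiv y hy).continuousAt.tendsto.mono_left nhdsWithin_le_nhds)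
  rw [inverseGammaMeasure_eq, withDensity_apply _ measurableSet_Iic,
    ← ofReal_integral_eq_lintegral_ofReal hint.integrableOn (Filter.Eventually.of_forall h0),
    setIntegral_eq_of_subset_of_forall_sdiff_eq_zero (s := Set.Ioc 0 y) measurableSet_Iic
      Set.Ioc_subset_Iic_self, ← intervalIntegral.integral_of_le hy.le, hFTC, sub_zero]
  intro x hx
  rw [inverseGammaPDFReal, if_neg fun h => hx.2 ⟨h, hx.1⟩]

/-! ### The generalized moment generating function as an expectation -/

section

variable {Ω : Type*} [MeasurableSpace Ω] {P : Measure Ω} [IsProbabilityMeasure P] {V : Ω → ℝ}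

/-- Absolute continuity ensures that the density loses no mass, and positivity makes the restriction
to the half-line harmless. -/
theorem gmgf_eq_integral_map (hac : P.map V ≪ volume) (hpos : ∀ᵐ v ∂P.map V, 0 < v) (n s : ℝ) :
    gmgf V P n s = ∫ v, v ^ n * Real.exp (v * s) ∂P.map V := by
  rw [gmgf, ← Measure.restrict_eq_self_of_ae_mem (s := Set.Ioi 0) hpos,
    ← setIntegral_rnDeriv_smul hac measurableSet_Ioi]
  refine integral_congr_ae (Filter.Eventually.of_forall fun x => ?_)
  simp only [gmgfIntegrand, pdf, smul_eq_mul]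
  ring

theorem integrableOn_gmgfIntegrand (hac : P.map V ≪ volume) {n s : ℝ}
    (h : Integrable (fun v => v ^ n * Real.exp (v * s)) (P.map V)) :
    IntegrableOn (gmgfIntegrand V P n s) (Set.Ioi 0) := by
  refine ((integrable_rnDeriv_smul_iff hac).2 h).integrableOn.congr
    (Filter.Eventually.of_forall fun x => ?_)
  simp only [gmgfIntegrand, pdf, smul_eq_mul]
  ring

/-- For `s < 0` the integrand is bounded on `v > 0`, so no tail estimate for `V` is needed. The
bound `(n / -s) ^ n` comes from `y ≤ exp y` at `y = -s * v / n`. -/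
theorem integrable_rpow_mul_exp_map (hpos : ∀ᵐ v ∂P.map V, 0 < v) {n s : ℝ} (hn : 0 < n)
    (hs : s < 0) : Integrable (fun v => v ^ n * Real.exp (v * s)) (P.map V) := by
  refine Integrable.of_bound (by fun_prop) ((n / -s) ^ n) ?_
  filter_upwards [hpos] with v hv
  have hs' : 0 < -s := by linarith
  have h1 : v ≤ n / -s * Real.exp (-s * v / n) := by
    have h := Real.add_one_le_exp (-s * v / n)
    calc v = n / -s * (-s * v / n) := by field_simp [hs'.ne, hs.ne]
      _ ≤ n / -s * Real.exp (-s * v / n) := by gcongr; linarith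
  have h2 : v ^ n ≤ (n / -s) ^ n * Real.exp (-s * v) := by
    refine (Real.rpow_le_rpow hv.le h1 hn.le).trans_eq ?_
    rw [Real.mul_rpow (by positivity) (by positivity), ← Real.exp_mul]
    congr 2
    field_simp
  rw [Real.norm_of_nonneg (by positivity)]
  calc v ^ n * Real.exp (v * s) ≤ (n / -s) ^ n * Real.exp (-s * v) * Real.exp (v * s) := by gcongr
    _ = (n / -s) ^ n := by rw [mul_assoc, ← Real.exp_add]; ring_nf; simp

/-! ### Products of an inverse gamma variable and an independent positive variable -/

theorem lintegral_map_composite {G : Ω → ℝ} {lam β : ℝ} (hG : HasLaw G (inverseGammaMeasure lam β) P)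
    (hV : AEMeasurable V P) (hGV : IndepFun G V P) (Zbar : ℝ) {f : ℝ → ENNReal}
    (hf : Measurable f) :
    ∫⁻ z, f z ∂P.map (fun ω => Zbar * G ω * V ω) =
      ∫⁻ v, ∫⁻ g, f (Zbar * v * g) ∂inverseGammaMeasure lam β ∂P.map V := by
  have hmeas : Measurable fun p : ℝ × ℝ => Zbar * p.1 * p.2 := by fun_prop
  have hprob := Measure.isProbabilityMeasure_map (μ := P) hG.aemeasurable
  have hprobV := Measure.isProbabilityMeasure_map (μ := P) hV
  have hjoint := (indepFun_iff_map_prod_eq_prod_map_map hG.aemeasurable hV).1 hGV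
  have hmap : P.map (fun ω => Zbar * G ω * V ω) =
      ((P.map G).prod (P.map V)).map fun p => Zbar * p.1 * p.2 := by
    rw [← hjoint, AEMeasurable.map_map_of_aemeasurable hmeas.aemeasurable
      (hG.aemeasurable.prodMk hV)]
    rfl
  rw [hmap, lintegral_map hf hmeas]
  refine (lintegral_prod_symm _ (hf.comp hmeas).aemeasurable).trans ?_
  rw [hG.map_eq]
  refine lintegral_congr fun v => lintegral_congr fun g => ?_
  rw [mul_right_comm]
  rfl

theorem inverseGammaPDFReal_mul_eq {lam Zbar v z : ℝ} (hlam : 1 < lam) (hZ : 0 < Zbar) (hv : 0 < v)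
    (hz : 0 < z) : inverseGammaPDFReal lam (Zbar * v * (lam - 1)) z =
      Zbar ^ lam * (lam - 1) ^ lam / (z ^ (lam + 1) * Real.Gamma lam) *
        (v ^ lam * Real.exp (v * ((1 - lam) * Zbar / z))) := by
  have hl : 0 ≤ lam - 1 := by linarith
  have hG := (Real.Gamma_pos_of_pos (by linarith : 0 < lam)).ne'
  rw [inverseGammaPDFReal, if_pos hz, Real.mul_rpow (by positivity) hl,
    Real.mul_rpow hZ.le hv.le, show -lam - 1 = -(lam + 1) by ring, Real.rpow_neg hz.le,
    show -(Zbar * v * (lam - 1) / z) = v * ((1 - lam) * Zbar / z) by ring]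
  field_simp

theorem lintegral_inverseGammaPDFReal_eq_compositePDF (hac : P.map V ≪ volume)
    (hpos : ∀ᵐ v ∂P.map V, 0 < v) {lam Zbar : ℝ} (hlam : 1 < lam) (hZ : 0 < Zbar) (z : ℝ) :
    ∫⁻ v, ENNReal.ofReal (inverseGammaPDFReal lam (Zbar * v * (lam - 1)) z) ∂P.map V =
      ENNReal.ofReal (compositePDF V P Zbar lam z) := by
  by_cases hz : 0 < z
  · have hs : (1 - lam) * Zbar / z < 0 :=
      div_neg_of_neg_of_pos (mul_neg_of_neg_of_pos (by linarith) hZ) hz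
    have hl : 0 < lam - 1 := by linarith
    have hG := Real.Gamma_pos_of_pos (by linarith : 0 < lam)
    rw [compositePDF, if_pos hz, gmgf_eq_integral_map hac hpos, ← integral_const_mul,
      ofReal_integral_eq_lintegral_ofReal
        ((integrable_rpow_mul_exp_map hpos (by linarith) hs).const_mul _)]
    · refine lintegral_congr_ae ?_
      filter_upwards [hpos] with v hv
      rw [inverseGammaPDFReal_mul_eq hlam hZ hv hz]
    · filter_upwards [hpos] with v hv
      positivity
  · simp [compositePDF, inverseGammaPDFReal, hz]

/-- Given `V = v`, scaling keeps the law inverse gamma; Tonelli then averages the conditional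
densities under the integral over a test set. -/
theorem hasLaw_composite {G : Ω → ℝ} {lam Zbar : ℝ}
    (hG : HasLaw G (inverseGammaMeasure lam (lam - 1)) P) (hV : AEMeasurable V P)
    (hGV : IndepFun G V P) (hac : P.map V ≪ volume) (hpos : ∀ᵐ v ∂P.map V, 0 < v)
    (hlam : 1 < lam) (hZ : 0 < Zbar) :
    HasLaw (fun ω => Zbar * G ω * V ω)
      (volume.withDensity fun z => ENNReal.ofReal (compositePDF V P Zbar lam z)) P := by
  have hprobV := Measure.isProbabilityMeasure_map (μ := P) hV
  have hjoint : Measurable fun p : ℝ × ℝ =>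
      ENNReal.ofReal (inverseGammaPDFReal lam (Zbar * p.1 * (lam - 1)) p.2) :=
    ENNReal.measurable_ofReal.comp ((measurable_uncurry_inverseGammaPDFReal lam).comp
      (by fun_prop : Measurable fun p : ℝ × ℝ => (Zbar * p.1 * (lam - 1), p.2)))
  refine ⟨(hG.aemeasurable.const_mul Zbar).mul hV, Measure.ext fun A hA => ?_⟩
  rw [← lintegral_indicator_one hA, lintegral_map_composite hG hV hGV Zbar
    (measurable_one.indicator hA), withDensity_apply _ hA]
  have hinner : ∀ᵐ v ∂P.map V, ∫⁻ g, A.indicator 1 (Zbar * v * g)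
      ∂inverseGammaMeasure lam (lam - 1) =
      ∫⁻ z in A, ENNReal.ofReal (inverseGammaPDFReal lam (Zbar * v * (lam - 1)) z) := by
    filter_upwards [hpos] with v hv
    rw [lintegral_comp_mul_inverseGammaMeasure (by linarith) (by positivity)
      (measurable_one.indicator hA), ← lintegral_indicator hA]
    refine lintegral_congr fun z => ?_
    by_cases hz : z ∈ A <;> simp [hz]
  rw [lintegral_congr_ae hinner, lintegral_lintegral_swap hjoint.aemeasurable]
  simp only [lintegral_inverseGammaPDFReal_eq_compositePDF hac hpos hlam hZ]

theorem cdf_composite {G : Ω → ℝ} {lam Zbar : ℝ}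
    (hG : HasLaw G (inverseGammaMeasure lam (lam - 1)) P) (hV : AEMeasurable V P)
    (hGV : IndepFun G V P) (hac : P.map V ≪ volume) (hpos : ∀ᵐ v ∂P.map V, 0 < v)
    (hlam : 1 < lam) (hZ : 0 < Zbar) {N : ℕ} (hN : lam = N) {z : ℝ} (hz : 0 < z) :
    cdf (P.map fun ω => Zbar * G ω * V ω) z =
      ∑ n ∈ Finset.range N, Zbar ^ n * (lam - 1) ^ n / (z ^ n * Real.Gamma (n + 1)) *
        gmgf V P n ((1 - lam) * Zbar / z) := by
  have hZmeas : AEMeasurable (fun ω => Zbar * G ω * V ω) P :=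
    (hG.aemeasurable.const_mul Zbar).mul hV
  have hprobZ := Measure.isProbabilityMeasure_map (μ := P) hZmeas
  have hprobV := Measure.isProbabilityMeasure_map (μ := P) hV
  have hprobG : IsProbabilityMeasure (inverseGammaMeasure lam (lam - 1)) :=
    hG.map_eq ▸ Measure.isProbabilityMeasure_map hG.aemeasurable
  have hl : 0 < lam - 1 := by linarith
  have hs : (1 - lam) * Zbar / z < 0 :=
    div_neg_of_neg_of_pos (mul_neg_of_neg_of_pos (by linarith) hZ) hz
  have hinner : ∀ᵐ v ∂P.map V, ∫⁻ g, (Set.Iic z).indicator 1 (Zbar * v * g)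
      ∂inverseGammaMeasure lam (lam - 1) =
      ENNReal.ofReal (poissonCDFSum N (Zbar * v * (lam - 1) / z)) := by
    filter_upwards [hpos] with v hv
    have hset : (fun g => (Set.Iic z).indicator (1 : ℝ → ENNReal) (Zbar * v * g)) =
        (Set.Iic (z / (Zbar * v))).indicator 1 := by
      funext g
      have : Zbar * v * g ≤ z ↔ g ≤ z / (Zbar * v) := by
        rw [le_div_iff₀' (by positivity)]
      simp only [Set.indicator_apply, Set.mem_Iic, this, Pi.one_apply]
    obtain ⟨M, rfl⟩ : ∃ M, N = M + 1 :=
      Nat.exists_eq_succ_of_ne_zero fun h => by rw [hN, h] at hlam; norm_num at hlam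
    rw [hset, lintegral_indicator_one measurableSet_Iic]
    subst hN
    rw [inverseGammaMeasure_Iic hl (by positivity)]
    congr 2
    field_simp
  have hterm : ∀ (v : ℝ) (n : ℕ), (Zbar * v * (lam - 1) / z) ^ n / (n.factorial : ℝ) *
      Real.exp (-(Zbar * v * (lam - 1) / z)) =
      Zbar ^ n * (lam - 1) ^ n / (z ^ n * Real.Gamma (n + 1)) *
        (v ^ (n : ℝ) * Real.exp (v * ((1 - lam) * Zbar / z))) := fun v n => by
    rw [Real.Gamma_nat_eq_factorial, Real.rpow_natCast,
      show -(Zbar * v * (lam - 1) / z) = v * ((1 - lam) * Zbar / z) by ring, div_pow, mul_pow,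
      mul_pow]
    field_simp
  have hint : ∀ n : ℕ, Integrable (fun v => v ^ (n : ℝ) * Real.exp (v * ((1 - lam) * Zbar / z)))
      (P.map V) := fun n => by
    -- Order zero is separate because the general bound divides by `n`; there the exponential alone
    -- is at most 1.
    rcases n.eq_zero_or_pos with rfl | hn
    · refine Integrable.of_bound (by fun_prop) 1 ?_
      filter_upwards [hpos] with v hv
      simpa using mul_nonpos_of_nonneg_of_nonpos hv.le hs.le
    · exact integrable_rpow_mul_exp_map hpos (by exact_mod_cast hn) hs
  rw [cdf_eq_real, Measure.real, ← lintegral_indicator_one measurableSet_Iic,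
    lintegral_map_composite hG hV hGV Zbar (measurable_one.indicator measurableSet_Iic),
    lintegral_congr_ae hinner, ← integral_eq_lintegral_of_nonneg_ae]
  · simp only [poissonCDFSum, hterm]
    rw [integral_finsetSum _ fun n _ => (hint n).const_mul _]
    refine Finset.sum_congr rfl fun n _ => ?_
    rw [integral_const_mul, gmgf_eq_integral_map hac hpos]
  · filter_upwards [hpos] with v hv
    exact Finset.sum_nonneg fun n _ => by positivity
  · unfold poissonCDFSum
    fun_prop

end

/-! ### Fluctuating two-ray variables and the composite model. -/

theorem IsFTR.map_properties {Ω : Type*} [MeasurableSpace Ω] {P : Measure Ω} {V : Ω → ℝ}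
    {γbar m K Δ : ℝ} (hV : IsFTR V P γbar m K Δ) :
    AEMeasurable V P ∧ P.map V ≪ volume ∧ ∀ᵐ v ∂P.map V, 0 < v := by
  obtain ⟨hm, V₁, V₂, σ, _, _, hσ, _, _, _, hlaw⟩ := hV
  refine ⟨hlaw.aemeasurable, ?_, ?_⟩
  · rw [hlaw.map_eq]
    exact twoRayPowerLaw_absolutelyContinuous hm hσ V₁ V₂
  · rw [hlaw.map_eq, ae_iff]
    simpa [Set.Iic] using twoRayPowerLaw_Iic_zero hm hσ V₁ V₂

/-- The single lower integral computed for the power law gives both claims: its finiteness is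
convergence, and its real value is the closed form. -/
theorem IsFTR.gmgf_eq_ftrGMGF {Ω : Type*} [MeasurableSpace Ω] {P : Measure Ω}
    [IsProbabilityMeasure P] {V : Ω → ℝ} {m K Δ : ℝ} (hV : IsFTR V P 1 m K Δ) (n : ℕ) {s : ℝ}
    (hs : s ≤ 0) :
    IntegrableOn (gmgfIntegrand V P n s) (Set.Ioi 0) ∧ gmgf V P n s = ftrGMGF 1 m K Δ n s := by
  obtain ⟨-, hac, hpos⟩ := hV.map_properties
  obtain ⟨hm, V₁, V₂, σ, hV₁, hV₂, hσ, hK, hΔ, hγ, hlaw⟩ := hV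
  obtain ⟨hval, h0⟩ := lintegral_pow_mul_exp_eq_ftrGMGF hm hV₁ hV₂ hσ hK hΔ hγ hs n
  rw [← hlaw.map_eq] at hval
  have hfun : (fun v : ℝ => v ^ n * Real.exp (s * v)) =
      fun v => v ^ (n : ℝ) * Real.exp (v * s) := by
    funext v; rw [Real.rpow_natCast, mul_comm s]
  have hnn : ∀ᵐ v ∂P.map V, 0 ≤ v ^ n * Real.exp (s * v) := by
    filter_upwards [hpos] with v hv
    positivity
  have hmeas : AEStronglyMeasurable (fun v => v ^ n * Real.exp (s * v)) (P.map V) := by fun_prop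
  refine ⟨integrableOn_gmgfIntegrand hac ?_, ?_⟩
  · rw [← hfun]
    refine ⟨hmeas, ?_⟩
    rw [hasFiniteIntegral_iff_ofReal hnn, hval]
    exact ENNReal.ofReal_lt_top
  · rw [gmgf_eq_integral_map hac hpos, ← hfun, integral_eq_lintegral_of_nonneg_ae hnn hmeas, hval,
      ENNReal.toReal_ofReal h0]

end

theorem mainTheorem4 {Ω : Type*} [MeasurableSpace Ω] (P : Measure Ω) [IsProbabilityMeasure P]
    (G V : Ω → ℝ) (Zbar lam β m K Δ : ℝ) (hZbar : 0 < Zbar)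
    (hlam : 0 < lam) (hβ : 0 < β)
    (hG : HasLaw G (inverseGammaMeasure lam β) P) (hGmean : ∫ ω, G ω ∂P = 1)
    (hV : IsFTR V P 1 m K Δ)
    (hGV : IndepFun G V P) :
    -- the density of `Z = Zbar * G * V`, for every real shape parameter
    (∀ z : ℝ, 0 < z →
      IntegrableOn (gmgfIntegrand V P lam ((1 - lam) * Zbar / z)) (Set.Ioi 0)) ∧
    HasLaw (fun ω => Zbar * G ω * V ω)
      (volume.withDensity fun z => ENNReal.ofReal (compositePDF V P Zbar lam z)) P ∧
    -- the distribution function of `Z`, for integer shape parameter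
    (∀ N : ℕ, lam = N → ∀ z : ℝ, 0 < z →
      cdf (P.map fun ω => Zbar * G ω * V ω) z =
        ∑ n ∈ Finset.range N, Zbar ^ n * (lam - 1) ^ n / (z ^ n * Real.Gamma (n + 1)) *
          gmgf V P n ((1 - lam) * Zbar / z)) ∧
    -- the closed form of the generalized moment generating function of `V`
    (∀ (n : ℕ) (s : ℝ), s ≤ 0 →
      IntegrableOn (gmgfIntegrand V P n s) (Set.Ioi 0) ∧ gmgf V P n s = ftrGMGF 1 m K Δ n s) ∧
    -- the resulting closed forms of density and distribution function, for integer shape parameter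
    (∀ N : ℕ, lam = N → ∀ z : ℝ, 0 < z →
      compositePDF V P Zbar lam z =
        Zbar ^ lam * (lam - 1) ^ lam / (z ^ (lam + 1) * Real.Gamma lam) *
          ftrGMGF 1 m K Δ N ((1 - lam) * Zbar / z) ∧
      cdf (P.map fun ω => Zbar * G ω * V ω) z =
        ∑ n ∈ Finset.range N, Zbar ^ n * (lam - 1) ^ n / (z ^ n * Real.Gamma (n + 1)) *
          ftrGMGF 1 m K Δ n ((1 - lam) * Zbar / z)) := by
  obtain ⟨hVmeas, hac, hpos⟩ := hV.map_properties
  have hmean : ∫ x, x ∂inverseGammaMeasure lam β = 1 := by rw [← hG.integral_eq, hGmean]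
  -- Unit mean eliminates `β` in favour of `lam - 1` and makes every GMGF argument `(1 - lam) * Zbar
  -- / z` strictly negative.
  obtain ⟨hlam1, rfl⟩ := inverseGamma_scale_of_mean_one hlam hβ hmean
  have hs : ∀ z : ℝ, 0 < z → (1 - lam) * Zbar / z < 0 := fun z hz =>
    div_neg_of_neg_of_pos (mul_neg_of_neg_of_pos (by linarith) hZbar) hz
  have hcdf : ∀ N : ℕ, lam = N → ∀ z : ℝ, 0 < z →
      cdf (P.map fun ω => Zbar * G ω * V ω) z =
        ∑ n ∈ Finset.range N, Zbar ^ n * (lam - 1) ^ n / (z ^ n * Real.Gamma (n + 1)) *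
          gmgf V P n ((1 - lam) * Zbar / z) := fun N hN z hz =>
    cdf_composite hG hVmeas hGV hac hpos hlam1 hZbar hN hz
  refine ⟨fun z hz => integrableOn_gmgfIntegrand hac (integrable_rpow_mul_exp_map hpos hlam (hs z hz)),
    hasLaw_composite hG hVmeas hGV hac hpos hlam1 hZbar, hcdf,
    fun n s hs => hV.gmgf_eq_ftrGMGF n hs, fun N hN z hz => ⟨?_, ?_⟩⟩
  · rw [compositePDF, if_pos hz, ← (hV.gmgf_eq_ftrGMGF N (hs z hz).le).2, ← hN]
  · rw [hcdf N hN z hz]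
    exact Finset.sum_congr rfl fun n _ => by rw [(hV.gmgf_eq_ftrGMGF n (hs z hz).le).2]
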